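/- Let $N\ge 1$ and let $f_1,\dots,f_m:\mathbb{R}^N\to\mathbb{R}$ satisfy, for every $i$: $f_i\in L^\infty(\mathbb{R}^N)$; the support of $f_i^+=\max(f_i,0)$ is compact; and there are a compact set $C_i\subset\mathbb{R}^N$ and a constant $c_i<0$ with $f_i\le c_i$ a.e. outside $C_i$. Let $W_0^{1,2}(\mathbb{R}^N)$ be the closure of $C_c^\infty(\mathbb{R}^N)$ in the Sobolev space $W^{1,2}(\mathbb{R}^N)$, and put $$K=\{(u_1,\dots,u_m)\in (W_0^{1,2}(\mathbb{R}^N))^m:\ u_i\ge 0\text{ a.e. for all } i\},$$ $$S=\{(u_1,\dots,u_m)\in K:\ u_iu_j=0\text{ a.e. for all } i\ne j\},$$ $$J(u_1,\dots,u_m)=\sum_{i=1}^m\int_{\mathbb{R}^N}\Big(\tfrac12|\nabla u_i|^2-f_iu_i\Big)\,dx\in(-\infty,+\infty],\qquad (u_1,\dots,u_m)\in K.$$ (The negative part of each integrand is integrable for $u_i\ge0$ in $L^2$, so each integral is well defined, possibly $+\infty$.) Functions are identified when they agree a.e., and $\operatorname{supp}(g)$ denotes the complement of the largest open set on which $g=0$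 a.e. Then: 1. $J$ has at least one minimizer over $S$. 2. For every minimizer $(\bar u_1,\dots,\bar u_m)$ of $J$ over $S$, each $\operatorname{supp}(\bar u_i)$ is compact. 3. $J$ has exactly one minimizer $(v_1,\dots,v_m)$ over $K$, and for every minimizer $(\bar u_1,\dots,\bar u_m)$ of $J$ over $S$, $$\operatorname{supp}(\bar u_i)\subseteq\operatorname{supp}(v_i),\qquad i=1,\dots,m.$$ -/

import Mathlib

open MeasureTheory Set Filter
open scoped ENNReal Topology ContDiff Gradient

noncomputable section

namespace Segregation

/-- The Euclidean space `ℝ^N`. -/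
abbrev E (N : ℕ) : Type := EuclideanSpace ℝ (Fin N)

/-- The space `L²(ℝ^N)` of real functions (modulo equality almost everywhere). -/
abbrev L2 (N : ℕ) : Type := Lp ℝ 2 (volume : Measure (E N))

/-- The space `L²(ℝ^N; ℝ^N)` of vector fields (modulo equality almost everywhere). -/
abbrev L2Vec (N : ℕ) : Type := Lp (E N) 2 (volume : Measure (E N))

/-- Test functions: smooth with compact support. -/
def IsTest {N : ℕ} (φ : E N → ℝ) : Prop :=
  ContDiff ℝ ∞ φ ∧ HasCompactSupport φ

/-- `G` is the weak (distributional) gradient of `u`. -/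
def HasWeakGradient {N : ℕ} (u : E N → ℝ) (G : E N → E N) : Prop :=
  ∀ φ : E N → ℝ, IsTest φ → ∫ x, u x • ∇ φ x = -∫ x, φ x • G x

/-- A weak gradient in `L²` is unique. -/
theorem HasWeakGradient.unique {N : ℕ} {u : E N → ℝ} {G H : L2Vec N}
    (hG : HasWeakGradient u G) (hH : HasWeakGradient u H) : G = H := by
  have hGl : LocallyIntegrable (G : E N → E N) volume :=
    (Lp.memLp G).locallyIntegrable (by norm_num)
  have hHl : LocallyIntegrable (H : E N → E N) volume :=
    (Lp.memLp H).locallyIntegrable (by norm_num)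
  have key := ae_eq_zero_of_integral_contDiff_smul_eq_zero (hGl.sub hHl) (by
    intro φ hφ hc
    have h := (hG φ ⟨hφ, hc⟩).symm.trans (hH φ ⟨hφ, hc⟩)
    have i1 : Integrable (fun x => φ x • G x) volume :=
      hGl.integrable_smul_left_of_hasCompactSupport hφ.continuous hc
    have i2 : Integrable (fun x => φ x • H x) volume :=
      hHl.integrable_smul_left_of_hasCompactSupport hφ.continuous hc
    simp only [Pi.sub_apply, smul_sub]
    rw [integral_sub i1 i2, neg_injective h, sub_self])
  apply Lp.ext
  filter_upwards [key] with x hx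
  exact sub_eq_zero.mp hx

/-- The Sobolev space `W^{1,2}(ℝ^N)`. -/
def W12 (N : ℕ) : Set (L2 N) :=
  {u | ∃ G : L2Vec N, HasWeakGradient u G}

open Classical in
/-- The weak gradient in `L²` of `u ∈ W^{1,2}(ℝ^N)` (and `0` for other `u`). -/
def weakGrad {N : ℕ} (u : L2 N) : L2Vec N :=
  if h : ∃ G : L2Vec N, HasWeakGradient u G then h.choose else 0

theorem weakGrad_eq {N : ℕ} {u : L2 N} {G : L2Vec N} (h : HasWeakGradient u G) :
    weakGrad u = G := by
  have hex : ∃ G : L2Vec N, HasWeakGradient u G := ⟨G, h⟩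
  rw [weakGrad, dif_pos hex]
  exact hex.choose_spec.unique h

/-- The space `W_0^{1,2}(ℝ^N)`: the closure of the test functions in `W^{1,2}(ℝ^N)`. -/
def W012 (N : ℕ) : Set (L2 N) :=
  {u | u ∈ W12 N ∧ ∀ ε : ℝ≥0∞, 0 < ε → ∃ φ : E N → ℝ, IsTest φ ∧
    eLpNorm (fun x => u x - φ x) 2 volume +
      eLpNorm (fun x => weakGrad u x - ∇ φ x) 2 volume < ε}

/-- The (essential) support of a function defined almost everywhere: the complement of the
largest open set on which it vanishes almost everywhere. -/
def essSupport {N : ℕ} (g : E N → ℝ) : Set (E N) :=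
  (volume.restrict (Function.support g)).support

/-- The Lebesgue integral `∫ g⁺ - ∫ g⁻` with values in `[-∞, ∞]`. It is only applied to functions
whose negative part is integrable. -/
def extIntegral {N : ℕ} (g : E N → ℝ) : EReal :=
  ((∫⁻ x, ENNReal.ofReal (g x) : ℝ≥0∞) : EReal) - ((∫⁻ x, ENNReal.ofReal (-g x) : ℝ≥0∞) : EReal)

/-- Bounded, with compactly supported positive part, and bounded above by a negative constant
outside a compact set. -/
def ConditionA {N : ℕ} (f : E N → ℝ) : Prop :=
  MemLp f ∞ volume ∧
  IsCompact (essSupport fun x => max (f x) 0) ∧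
  ∃ C : Set (E N), IsCompact C ∧ ∃ c : ℝ, c < 0 ∧ ∀ᵐ x, x ∉ C → f x ≤ c

/-- Vectors of nonnegative functions in `W_0^{1,2}(ℝ^N)`. -/
def K (N m : ℕ) : Set (Fin m → L2 N) :=
  {u | ∀ i, u i ∈ W012 N ∧ ∀ᵐ x, 0 ≤ u i x}

/-- Segregated vectors of nonnegative functions in `W_0^{1,2}(ℝ^N)`. -/
def S (N m : ℕ) : Set (Fin m → L2 N) :=
  {u | (∀ i, u i ∈ W012 N ∧ ∀ᵐ x, 0 ≤ u i x) ∧ ∀ i j, i ≠ j → ∀ᵐ x, u i x * u j x = 0}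

/-- The functional `J`. It may take the value `+∞`, because `f i * u i` need not be integrable. -/
def J {N m : ℕ} (f : Fin m → E N → ℝ) (u : Fin m → L2 N) : EReal :=
  ∑ i, extIntegral fun x => (1 / 2 : ℝ) * ‖weakGrad (u i) x‖ ^ 2 - f i x * u i x

/-- `u` is a minimizer of `J` over the class `A`. -/
def IsMinimizer {N m : ℕ} (f : Fin m → E N → ℝ) (A : Set (Fin m → L2 N))
    (u : Fin m → L2 N) : Prop :=
  u ∈ A ∧ IsMinOn (J f) A u

end Segregation

end

/-! Existence is the direct method. The energy has no L² penalty: besides the gradient it controls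
only the L¹ norm, through f ≤ -c off a set `D` of finite measure. The missing bounds come from one
inequality, ‖u - avg_R u‖₂ ≤ R ‖∇u‖₂, with avg_R the mean over balls of radius R
(`HasGrad.lintegral_sub_ballAvg_le`). For u ≥ 0 the mean is at most |B_R|⁻¹ ∫ u, so for large R the
mass on `D` is absorbed into c ∫ u; R = 1 then bounds the L² norm (`Tame.exists_coercive`). As R → 0
the same inequality turns weak into a.e. convergence (`HasGrad.exists_subseq`). Fatou's lemma gives
lower semicontinuity, and the constraint u_i u_j = 0 survives a.e. limits.

Uniqueness over `K`: at the midpoint of two minimizers the parallelogram identity forces equal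
gradients, and for N ≥ 1 only 0 has zero gradient in W_0^{1,2}.

Comparison rests on submodularity, E(u ⊓ v) + E(u ⊔ v) ≤ E(u) + E(v). If u minimizes over `S` and v
over `K`, then u ⊓ v is still segregated, so E(u) ≤ E(u ⊓ v) and hence E(u ⊔ v) ≤ E(v). Uniqueness
gives u ⊔ v = v, that is u ≤ v (`IsMinimizer.ae_le`), and the supports are nested.

Compactness: each v_i minimizes its own scalar energy. Submodularity against a compactly supported
radial w with -Δw = F ≥ f_i (`exists_barrier`) gives v_i ≤ w, so the supports of v_i and of u_i ≤
v_i are compact. -/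

noncomputable section

namespace Segregation

variable {N m : ℕ}

/-! ### Weak convergence in Hilbert space -/

section Hilbert

variable {H : Type*} [NormedAddCommGroup H] [InnerProductSpace ℝ H]

/-- A bounded sequence in a separable Hilbert space has a weakly convergent subsequence. -/
theorem exists_weak_subseq [CompleteSpace H] [TopologicalSpace.SeparableSpace H] {x : ℕ → H} {C : ℝ}
    (hx : ∀ n, ‖x n‖ ≤ C) :
    ∃ (z : H) (s : ℕ → ℕ), StrictMono s ∧
      ∀ y : H, Tendsto (fun n => inner ℝ (x (s n)) y) atTop (𝓝 (inner ℝ z y)) := by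
  let T := InnerProductSpace.toDual ℝ H
  obtain ⟨z, -, s, hs, hz⟩ := WeakDual.isSeqCompact_closedBall ℝ H (0 : StrongDual ℝ H) C
    (x := fun n => StrongDual.toWeakDual (T (x n))) (fun n => by simpa [T] using hx n)
  refine ⟨T.symm (WeakDual.toStrongDual z), s, hs, fun y => ?_⟩
  have h1 := ((WeakDual.eval_continuous (𝕜 := ℝ) y).tendsto z).comp hz
  have h2 : inner ℝ (T.symm (WeakDual.toStrongDual z)) y = z y := by
    rw [InnerProductSpace.toDual_symm_apply]; rfl
  rw [h2]
  exact h1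

/-- Test the weak convergence against z itself and cancel one factor ‖z‖. -/
theorem norm_le_of_weak_tendsto {x : ℕ → H} {z : H} {c : ℝ} {b : ℕ → ℝ}
    (h : ∀ y, Tendsto (fun n => inner ℝ (x n) y) atTop (𝓝 (inner ℝ z y)))
    (hb : ∀ n, ‖x n‖ ≤ b n) (hc : Tendsto b atTop (𝓝 c)) : ‖z‖ ≤ c := by
  have hc0 : 0 ≤ c := ge_of_tendsto' hc fun n => (norm_nonneg _).trans (hb n)
  have h1 : ‖z‖ * ‖z‖ ≤ c * ‖z‖ := by
    rw [← real_inner_self_eq_norm_mul_norm]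
    refine le_of_tendsto_of_tendsto' (h z) (hc.mul_const _) fun n => ?_
    exact (real_inner_le_norm _ _).trans (mul_le_mul_of_nonneg_right (hb n) (norm_nonneg _))
  by_contra! hlt
  nlinarith [norm_nonneg z]

/-- A closed subspace equals its double orthogonal complement, hence is cut out by inner products,
which pass to weak limits. Applied to `sobolevGraph`, it keeps a weak limit of pairs (function,
gradient) such a pair. -/
theorem mem_of_weak_tendsto [CompleteSpace H] (V : Submodule ℝ H) (hV : IsClosed (V : Set H))
    {x : ℕ → H} {z : H}
    (h : ∀ y, Tendsto (fun n => inner ℝ (x n) y) atTop (𝓝 (inner ℝ z y)))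
    (hx : ∀ n, x n ∈ V) : z ∈ V := by
  have : CompleteSpace V := hV.completeSpace_coe
  rw [← V.orthogonal_orthogonal, Submodule.mem_orthogonal']
  intro y hy
  refine tendsto_nhds_unique (h y) (tendsto_const_nhds.congr fun n => ?_)
  exact (V.inner_right_of_mem_orthogonal (hx n) hy).symm

end Hilbert

/-! ### Test functions and the closed graph of the gradient -/

namespace IsTest

variable {φ ψ : E N → ℝ}

theorem differentiable (h : IsTest φ) : Differentiable ℝ φ :=
  h.1.differentiable (by simp)

theorem continuous_gradient (h : IsTest φ) : Continuous (∇ φ) :=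
  (InnerProductSpace.toDual ℝ (E N)).symm.continuous.comp (h.1.continuous_fderiv (by simp))

theorem hasCompactSupport_gradient (h : IsTest φ) : HasCompactSupport (∇ φ) :=
  (h.2.fderiv (𝕜 := ℝ)).comp_left (g := (InnerProductSpace.toDual ℝ (E N)).symm) (map_zero _)

theorem memLp (h : IsTest φ) : MemLp φ 2 volume :=
  h.1.continuous.memLp_of_hasCompactSupport h.2

theorem memLp_gradient (h : IsTest φ) : MemLp (∇ φ) 2 volume :=
  h.continuous_gradient.memLp_of_hasCompactSupport h.hasCompactSupport_gradient

theorem gradient_add (h : IsTest φ) (h' : IsTest ψ) : ∇ (φ + ψ) = ∇ φ + ∇ ψ := by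
  funext x
  simp [gradient, fderiv_add (h.differentiable x) (h'.differentiable x)]

theorem gradient_smul (h : IsTest φ) (c : ℝ) : ∇ (c • φ) = c • ∇ φ := by
  funext x
  simp [gradient, fderiv_const_smul (h.differentiable x)]

theorem add (h : IsTest φ) (h' : IsTest ψ) : IsTest (φ + ψ) :=
  ⟨h.1.add h'.1, h.2.add h'.2⟩

theorem smul (h : IsTest φ) (c : ℝ) : IsTest (c • φ) :=
  ⟨h.1.const_smul c, h.2.smul_left (f := fun _ => c)⟩

/-- Integration by parts in the direction `v`. -/
theorem integral_mul_inner_gradient (h : IsTest φ) (h' : IsTest ψ) (v : E N) :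
    ∫ x, φ x * inner ℝ (∇ ψ x) v = -∫ x, inner ℝ (∇ φ x) v * ψ x := by
  simp only [inner_gradient_left]
  have c1 : Continuous fun x => fderiv ℝ φ x v :=
    (h.1.continuous_fderiv (by simp)).clm_apply continuous_const
  have c2 : Continuous fun x => fderiv ℝ ψ x v :=
    (h'.1.continuous_fderiv (by simp)).clm_apply continuous_const
  refine integral_mul_fderiv_eq_neg_fderiv_mul_of_integrable ?_ ?_ ?_
    (fun x _ => h.differentiable x) (fun x _ => h'.differentiable x)
  · exact (c1.mul h'.1.continuous).integrable_of_hasCompactSupport h'.2.mul_left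
  · exact (h.1.continuous.mul c2).integrable_of_hasCompactSupport h.2.mul_right
  · exact (h.1.continuous.mul h'.1.continuous).integrable_of_hasCompactSupport h.2.mul_right

end IsTest

theorem isTest_zero : IsTest (0 : E N → ℝ) := ⟨contDiff_const, HasCompactSupport.zero⟩

/-- The graph of the gradient on test functions. -/
def testGraph (N : ℕ) : Submodule ℝ (WithLp 2 (L2 N × L2Vec N)) where
  carrier := {p | ∃ φ : E N → ℝ, IsTest φ ∧ p.fst =ᵐ[volume] φ ∧ p.snd =ᵐ[volume] ∇ φ}
  zero_mem' := by
    refine ⟨0, isTest_zero, Lp.coeFn_zero _ _ _, ?_⟩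
    rw [show ∇ (0 : E N → ℝ) = 0 from gradient_const' 0]
    exact Lp.coeFn_zero _ _ _
  add_mem' := by
    rintro p q ⟨φ, hφ, h1, h2⟩ ⟨ψ, hψ, h3, h4⟩
    refine ⟨φ + ψ, hφ.add hψ, (Lp.coeFn_add _ _).trans (h1.add h3), ?_⟩
    rw [hφ.gradient_add hψ]
    exact (Lp.coeFn_add _ _).trans (h2.add h4)
  smul_mem' := by
    rintro c p ⟨φ, hφ, h1, h2⟩
    refine ⟨c • φ, hφ.smul c, (Lp.coeFn_smul _ _).trans (h1.const_smul c), ?_⟩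
    rw [hφ.gradient_smul]
    exact (Lp.coeFn_smul _ _).trans (h2.const_smul c)

/-- The closure of the graph of the gradient: pairs of a function in `W_0^{1,2}` and its weak
gradient. -/
def sobolevGraph (N : ℕ) : Submodule ℝ (WithLp 2 (L2 N × L2Vec N)) :=
  (testGraph N).topologicalClosure

/-- `u ∈ W_0^{1,2}(ℝ^N)` has weak gradient `G`. -/
def HasGrad (u : L2 N) (G : L2Vec N) : Prop := WithLp.toLp 2 (u, G) ∈ sobolevGraph N

theorem isClosed_sobolevGraph : IsClosed (sobolevGraph N : Set (WithLp 2 (L2 N × L2Vec N))) :=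
  Submodule.isClosed_topologicalClosure _

namespace HasGrad

variable {u w : L2 N} {G F : L2Vec N}

theorem add (h : HasGrad u G) (h' : HasGrad w F) : HasGrad (u + w) (G + F) :=
  (sobolevGraph N).add_mem h h'

theorem sub (h : HasGrad u G) (h' : HasGrad w F) : HasGrad (u - w) (G - F) :=
  (sobolevGraph N).sub_mem h h'

theorem smul (c : ℝ) (h : HasGrad u G) : HasGrad (c • u) (c • G) :=
  (sobolevGraph N).smul_mem c h

theorem zero : HasGrad (0 : L2 N) 0 := (sobolevGraph N).zero_mem

/-- Approximation by test functions in the graph norm. -/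
theorem exists_tendsto (h : HasGrad u G) : ∃ (φ : ℕ → E N → ℝ) (U : ℕ → L2 N) (V : ℕ → L2Vec N),
    (∀ n, IsTest (φ n)) ∧ (∀ n, U n =ᵐ[volume] φ n) ∧ (∀ n, V n =ᵐ[volume] ∇ (φ n)) ∧
      Tendsto U atTop (𝓝 u) ∧ Tendsto V atTop (𝓝 G) := by
  have h0 : WithLp.toLp 2 (u, G) ∈ closure (testGraph N : Set (WithLp 2 (L2 N × L2Vec N))) := h
  obtain ⟨p, hp, hlim⟩ := mem_closure_iff_seq_limit.1 h0
  choose φ hφ h1 h2 using hp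
  exact ⟨φ, fun n => (p n).fst, fun n => (p n).snd, hφ, h1, h2,
    ((WithLp.continuous_fst 2 (L2 N) (L2Vec N)).tendsto _).comp hlim,
    ((WithLp.continuous_snd 2 (L2 N) (L2Vec N)).tendsto _).comp hlim⟩

/-- A continuous linear identity on the graph holds if it holds for test functions. -/
theorem inner_add_inner_eq_zero (h : HasGrad u G) {a : E N → ℝ} {b : E N → E N}
    (ha : MemLp a 2 volume) (hb : MemLp b 2 volume)
    (hab : ∀ φ, IsTest φ → ∫ x, φ x * a x + inner ℝ (∇ φ x) (b x) = 0) :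
    (∫ x, u x * a x) + ∫ x, inner ℝ (G x) (b x) = 0 := by
  have key : ∀ (U : L2 N) (V : L2Vec N), inner ℝ U (ha.toLp a) + inner ℝ V (hb.toLp b) =
      (∫ x, U x * a x) + ∫ x, inner ℝ (V x) (b x) := by
    intro U V
    rw [L2.inner_def, L2.inner_def]
    congr 1
    · refine integral_congr_ae ?_
      filter_upwards [ha.coeFn_toLp] with x hx
      simp [hx, mul_comm]
    · refine integral_congr_ae ?_
      filter_upwards [hb.coeFn_toLp] with x hx
      simp [hx]
  obtain ⟨φ, U, V, hφ, hU, hV, hUl, hVl⟩ := h.exists_tendsto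
  rw [← key]
  refine tendsto_nhds_unique ((hUl.inner tendsto_const_nhds).add (hVl.inner tendsto_const_nhds))
    (tendsto_const_nhds.congr fun n => ?_)
  rw [key, ← hab (φ n) (hφ n), integral_add]
  · congr 1
    · exact integral_congr_ae (by filter_upwards [hU n] with x hx; rw [hx])
    · exact integral_congr_ae (by filter_upwards [hV n] with x hx; rw [hx])
  · exact (hφ n).memLp.integrable_mul ha
  · refine (L2.integrable_inner (𝕜 := ℝ) ((hφ n).memLp_gradient.toLp _) (hb.toLp b)).congr ?_
    filter_upwards [(hφ n).memLp_gradient.coeFn_toLp, hb.coeFn_toLp] with x h1 h2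
    rw [h1, h2]

/-- For each direction v, integration by parts is a linear identity on the graph, with a = ⟨∇φ, v⟩
and b = φ v, so it extends from test functions to the closure. -/
theorem hasWeakGradient (h : HasGrad u G) : HasWeakGradient u G := by
  intro φ hφ
  refine ext_inner_right ℝ fun v => ?_
  have i1 : Integrable (fun x => u x • ∇ φ x) volume :=
    memLp_one_iff_integrable.1 (hφ.memLp_gradient.smul (Lp.memLp u))
  have i2 : Integrable (fun x => φ x • G x) volume :=
    memLp_one_iff_integrable.1 ((Lp.memLp G).smul hφ.memLp)
  rw [inner_neg_left, real_inner_comm, real_inner_comm v, ← integral_inner i1, ← integral_inner i2]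
  have hb : MemLp (fun x => φ x • v) 2 volume :=
    (hφ.1.continuous.smul continuous_const).memLp_of_hasCompactSupport hφ.2.smul_right
  have := h.inner_add_inner_eq_zero (hφ.memLp_gradient.inner_const v) hb (by
    intro ψ hψ
    have e := hψ.integral_mul_inner_gradient hφ v
    rw [integral_add]
    · rw [e]
      simp [inner_smul_right, mul_comm]
    · exact hψ.memLp.integrable_mul (hφ.memLp_gradient.inner_const v)
    · refine Continuous.integrable_of_hasCompactSupport
        (hψ.continuous_gradient.inner (hφ.1.continuous.smul continuous_const)) ?_
      exact hψ.hasCompactSupport_gradient.mono' fun x hx => by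
        apply subset_tsupport
        intro h0
        exact hx (by simp only [h0, inner_zero_left]))
  rw [← eq_neg_iff_add_eq_zero] at this
  simpa [inner_smul_right, inner_smul_left, real_inner_comm] using this

theorem weakGrad_eq (h : HasGrad u G) : weakGrad u = G :=
  Segregation.weakGrad_eq h.hasWeakGradient

theorem unique (h : HasGrad u G) (h' : HasGrad u F) : G = F :=
  h.hasWeakGradient.unique h'.hasWeakGradient

end HasGrad

theorem IsTest.hasGrad {φ : E N → ℝ} (h : IsTest φ) :
    HasGrad (h.memLp.toLp φ) (h.memLp_gradient.toLp (∇ φ)) :=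
  Submodule.le_topologicalClosure _ ⟨φ, h, h.memLp.coeFn_toLp, h.memLp_gradient.coeFn_toLp⟩

/-- The sum of two L² norms and the Hilbert norm of the pair define the same closure. From here on
W_0^{1,2} is a closed subspace of a Hilbert space. -/
theorem mem_W012_iff {u : L2 N} : u ∈ W012 N ↔ HasGrad u (weakGrad u) := by
  constructor
  · rintro ⟨-, h⟩
    refine Metric.mem_closure_iff.2 fun ε hε => ?_
    obtain ⟨φ, hφ, hlt⟩ := h (ENNReal.ofReal (ε / 2)) (by simpa using hε)
    refine ⟨WithLp.toLp 2 (hφ.memLp.toLp φ, hφ.memLp_gradient.toLp (∇ φ)),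
      ⟨φ, hφ, hφ.memLp.coeFn_toLp, hφ.memLp_gradient.coeFn_toLp⟩, ?_⟩
    have e1 : eLpNorm (fun x => u x - φ x) 2 volume = ‖u - hφ.memLp.toLp φ‖ₑ := by
      rw [Lp.enorm_def]
      refine eLpNorm_congr_ae ?_
      filter_upwards [Lp.coeFn_sub u (hφ.memLp.toLp φ), hφ.memLp.coeFn_toLp] with x h1 h2
      rw [h1, Pi.sub_apply, h2]
    have e2 : eLpNorm (fun x => weakGrad u x - ∇ φ x) 2 volume =
        ‖weakGrad u - hφ.memLp_gradient.toLp (∇ φ)‖ₑ := by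
      rw [Lp.enorm_def]
      refine eLpNorm_congr_ae ?_
      filter_upwards [Lp.coeFn_sub (weakGrad u) (hφ.memLp_gradient.toLp (∇ φ)),
        hφ.memLp_gradient.coeFn_toLp] with x h1 h2
      rw [h1, Pi.sub_apply, h2]
    rw [e1, e2, ← ofReal_norm, ← ofReal_norm, ← ENNReal.ofReal_add (norm_nonneg _) (norm_nonneg _),
      ENNReal.ofReal_lt_ofReal_iff (by positivity)] at hlt
    rw [dist_eq_norm]
    refine lt_of_pow_lt_pow_left₀ 2 hε.le ?_
    rw [WithLp.prod_norm_sq_eq_of_L2]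
    change ‖u - hφ.memLp.toLp φ‖ ^ 2 + ‖weakGrad u - hφ.memLp_gradient.toLp (∇ φ)‖ ^ 2 < ε ^ 2
    have h1 := norm_nonneg (u - hφ.memLp.toLp φ)
    have h2 := norm_nonneg (weakGrad u - hφ.memLp_gradient.toLp (∇ φ))
    nlinarith
  · intro h
    refine ⟨⟨_, h.hasWeakGradient⟩, fun ε hε => ?_⟩
    obtain ⟨φ, U, V, hφ, hU, hV, hUl, hVl⟩ := h.exists_tendsto
    rw [Lp.tendsto_Lp_iff_tendsto_eLpNorm'] at hUl hVl
    have hs := hUl.add hVl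
    rw [add_zero] at hs
    obtain ⟨n, hn⟩ := (hs.eventually_lt_const hε).exists
    refine ⟨φ n, hφ n, ?_⟩
    convert hn using 2
    · rw [← eLpNorm_neg]
      refine eLpNorm_congr_ae ?_
      filter_upwards [hU n] with x hx
      simp [hx]
    · rw [← eLpNorm_neg]
      refine eLpNorm_congr_ae ?_
      filter_upwards [hV n] with x hx
      simp [hx]

/-- Bounded sequences in `W_0^{1,2}` have weakly convergent subsequences. -/
theorem HasGrad.exists_weak_subseq {u : ℕ → L2 N} {G : ℕ → L2Vec N} {C D : ℝ}
    (h : ∀ n, HasGrad (u n) (G n)) (hu : ∀ n, ‖u n‖ ≤ C) (hG : ∀ n, ‖G n‖ ≤ D) :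
    ∃ (z : L2 N) (F : L2Vec N) (s : ℕ → ℕ), StrictMono s ∧ HasGrad z F ∧
      (∀ y, Tendsto (fun n => inner ℝ (u (s n)) y) atTop (𝓝 (inner ℝ z y))) ∧
      ∀ y, Tendsto (fun n => inner ℝ (G (s n)) y) atTop (𝓝 (inner ℝ F y)) := by
  have hb : ∀ n, ‖WithLp.toLp 2 (u n, G n)‖ ≤ C + D := by
    intro n
    refine le_of_sq_le_sq ?_ (by linarith [norm_nonneg (u n), norm_nonneg (G n), hu n, hG n])
    rw [WithLp.prod_norm_sq_eq_of_L2]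
    change ‖u n‖ ^ 2 + ‖G n‖ ^ 2 ≤ _
    nlinarith [norm_nonneg (u n), norm_nonneg (G n), hu n, hG n]
  have : Fact ((2 : ℝ≥0∞) ≠ ⊤) := ⟨by norm_num⟩
  have : SecondCountableTopology (L2 N) := Lp.SecondCountableTopology
  have : SecondCountableTopology (L2Vec N) := Lp.SecondCountableTopology
  have : SecondCountableTopology (WithLp 2 (L2 N × L2Vec N)) :=
    WithLp.secondCountableTopology 2 (L2 N) (L2Vec N)
  obtain ⟨z, s, hs, hz⟩ := Segregation.exists_weak_subseq hb
  refine ⟨z.fst, z.snd, s, hs,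
    mem_of_weak_tendsto (sobolevGraph N) isClosed_sobolevGraph hz fun n => h (s n),
    fun y => ?_, fun y => ?_⟩
  · simpa [WithLp.prod_inner_apply] using hz (WithLp.toLp 2 (y, 0))
  · simpa [WithLp.prod_inner_apply] using hz (WithLp.toLp 2 (0, y))

/-- Lower semicontinuity of the Dirichlet norm along strongly convergent sequences. -/
theorem HasGrad.exists_of_tendsto {u : ℕ → L2 N} {G : ℕ → L2Vec N} {z : L2 N} {b : ℕ → ℝ} {c : ℝ}
    (h : ∀ n, HasGrad (u n) (G n)) (hu : Tendsto u atTop (𝓝 z)) (hG : ∀ n, ‖G n‖ ≤ b n)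
    (hb : Tendsto b atTop (𝓝 c)) : ∃ F, HasGrad z F ∧ ‖F‖ ≤ c := by
  obtain ⟨C, hC⟩ := hu.norm.bddAbove_range
  obtain ⟨D, hD⟩ := hb.bddAbove_range
  obtain ⟨w, F, s, hs, hF, h1, h2⟩ := HasGrad.exists_weak_subseq h
    (fun n => hC ⟨n, rfl⟩) (fun n => (hG n).trans (hD ⟨n, rfl⟩))
  have hw : w = z := by
    refine ext_inner_right ℝ fun y => tendsto_nhds_unique (h1 y) ?_
    exact (hu.inner tendsto_const_nhds).comp hs.tendsto_atTop
  subst hw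
  exact ⟨F, hF, norm_le_of_weak_tendsto h2 (fun n => hG (s n)) (hb.comp hs.tendsto_atTop)⟩

/-! ### Absolute value, minimum and maximum in W_0^{1,2} -/

/-- A smooth approximation of the absolute value. -/
def smoothAbs (ε t : ℝ) : ℝ := √(t ^ 2 + ε ^ 2) - ε

section smoothAbs

variable {ε : ℝ}

theorem contDiff_smoothAbs (hε : 0 < ε) : ContDiff ℝ ∞ (smoothAbs ε) :=
  (((contDiff_id.pow 2).add contDiff_const).sqrt fun t => by
    have : 0 < t ^ 2 + ε ^ 2 := by positivity
    exact this.ne').sub contDiff_const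

/-- This is the purpose of subtracting ε: composition with `smoothAbs ε` then preserves compact
support. -/
theorem smoothAbs_zero (hε : 0 < ε) : smoothAbs ε 0 = 0 := by
  simp [smoothAbs, Real.sqrt_sq hε.le]

theorem abs_deriv_smoothAbs_le (hε : 0 < ε) (t : ℝ) : |deriv (smoothAbs ε) t| ≤ 1 := by
  have h0 : 0 < t ^ 2 + ε ^ 2 := by positivity
  have h1 : HasDerivAt (smoothAbs ε) (2 * t / (2 * √(t ^ 2 + ε ^ 2))) t := by
    have : HasDerivAt (smoothAbs ε) _ t :=
      ((((hasDerivAt_id t).pow 2).add_const (ε ^ 2)).sqrt (by simpa using h0.ne')).sub_const ε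
    simpa using this
  rw [h1.deriv, mul_div_mul_left _ _ two_ne_zero, abs_div, abs_of_nonneg (Real.sqrt_nonneg _),
    div_le_one (Real.sqrt_pos.2 h0)]
  exact Real.abs_le_sqrt (by nlinarith)

theorem abs_smoothAbs_sub_le (hε : 0 < ε) (t : ℝ) : |smoothAbs ε t - abs t| ≤ ε := by
  have h1 : |t| ≤ √(t ^ 2 + ε ^ 2) := Real.abs_le_sqrt (by nlinarith)
  have h2 : √(t ^ 2 + ε ^ 2) ≤ |t| + ε := by
    rw [Real.sqrt_le_left (by positivity)]
    nlinarith [sq_abs t, abs_nonneg t]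
  rw [abs_le, smoothAbs]
  constructor <;> linarith

end smoothAbs

theorem IsTest.smoothAbs {φ : E N → ℝ} (h : IsTest φ) {ε : ℝ} (hε : 0 < ε) :
    IsTest (smoothAbs ε ∘ φ) :=
  ⟨(contDiff_smoothAbs hε).comp h.1, h.2.comp_left (smoothAbs_zero hε)⟩

theorem norm_gradient (φ : E N → ℝ) (x : E N) : ‖∇ φ x‖ = ‖fderiv ℝ φ x‖ :=
  LinearIsometryEquiv.norm_map _ _

theorem IsTest.norm_gradient_smoothAbs_le {φ : E N → ℝ} (h : IsTest φ) {ε : ℝ} (hε : 0 < ε)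
    (x : E N) : ‖∇ (Segregation.smoothAbs ε ∘ φ) x‖ ≤ ‖∇ φ x‖ := by
  have h1 : HasFDerivAt (Segregation.smoothAbs ε ∘ φ)
      (deriv (Segregation.smoothAbs ε) (φ x) • fderiv ℝ φ x) x :=
    HasDerivAt.comp_hasFDerivAt x
      (((contDiff_smoothAbs hε).differentiable (by simp)) (φ x)).hasDerivAt
      (h.differentiable x).hasFDerivAt
  rw [norm_gradient, norm_gradient, h1.fderiv, norm_smul]
  exact mul_le_of_le_one_left (norm_nonneg _) (abs_deriv_smoothAbs_le hε _)

/-- The smoothed absolute values are test functions, have no larger gradient, and differ from |φ| by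
at most ε_n, only on the compact support of φ. Weak compactness supplies the gradient, so no chain
rule for |φ| is needed. -/
theorem IsTest.exists_hasGrad_abs {φ : E N → ℝ} (h : IsTest φ) :
    ∃ F, HasGrad |h.memLp.toLp φ| F ∧ ‖F‖ ≤ ‖h.memLp_gradient.toLp (∇ φ)‖ := by
  let ε : ℕ → ℝ := fun n => 1 / ((n : ℝ) + 1)
  have hε : ∀ n, 0 < ε n := fun n => Nat.one_div_pos_of_nat
  have hS : MeasurableSet (tsupport φ) := (isClosed_tsupport φ).measurableSet
  have hS' : volume (tsupport φ) ≠ ⊤ := h.2.measure_lt_top.ne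
  refine HasGrad.exists_of_tendsto (fun n => (h.smoothAbs (hε n)).hasGrad) ?_ (fun n => ?_)
    tendsto_const_nhds
  · rw [tendsto_iff_norm_sub_tendsto_zero]
    refine squeeze_zero (fun n => norm_nonneg _)
      (g := fun n => ε n * ‖indicatorConstLp 2 hS hS' (1 : ℝ)‖) (fun n => ?_) ?_
    · refine Lp.norm_le_mul_norm_of_ae_le_mul ?_
      filter_upwards [Lp.coeFn_sub ((h.smoothAbs (hε n)).memLp.toLp _) |h.memLp.toLp φ|,
        (h.smoothAbs (hε n)).memLp.coeFn_toLp, Lp.coeFn_abs (h.memLp.toLp φ), h.memLp.coeFn_toLp,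
        indicatorConstLp_coeFn (p := 2) (hs := hS) (hμs := hS') (c := (1 : ℝ))] with x h1 h2 h3 h4 h5
      rw [h1, Pi.sub_apply, h2, h3, h4, h5]
      by_cases hx : x ∈ tsupport φ
      · rw [Set.indicator_of_mem hx]
        simpa using abs_smoothAbs_sub_le (hε n) (φ x)
      · rw [Set.indicator_of_notMem hx]
        simp [image_eq_zero_of_notMem_tsupport hx, smoothAbs_zero (hε n)]
    · simpa [ε] using tendsto_one_div_add_atTop_nhds_zero_nat.mul_const
        ‖indicatorConstLp 2 hS hS' (1 : ℝ)‖
  · refine Lp.norm_le_norm_of_ae_le ?_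
    filter_upwards [(h.smoothAbs (hε n)).memLp_gradient.coeFn_toLp,
      h.memLp_gradient.coeFn_toLp] with x h1 h2
    rw [h1, h2]
    exact h.norm_gradient_smoothAbs_le (hε n) x

namespace HasGrad

variable {u w : L2 N} {G F : L2Vec N}

/-- Taking absolute values does not increase the Dirichlet norm. -/
theorem exists_abs (h : HasGrad u G) : ∃ F, HasGrad |u| F ∧ ‖F‖ ≤ ‖G‖ := by
  obtain ⟨φ, U, V, hφ, hU, hV, hUl, hVl⟩ := h.exists_tendsto
  have hU' : ∀ n, (hφ n).memLp.toLp (φ n) = U n := fun n =>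
    Lp.ext ((hφ n).memLp.coeFn_toLp.trans (hU n).symm)
  have hV' : ∀ n, (hφ n).memLp_gradient.toLp (∇ (φ n)) = V n := fun n =>
    Lp.ext ((hφ n).memLp_gradient.coeFn_toLp.trans (hV n).symm)
  choose F hF hle using fun n => (hφ n).exists_hasGrad_abs
  simp only [hU', hV'] at hF hle
  refine exists_of_tendsto hF ?_ hle hVl.norm
  rw [tendsto_iff_norm_sub_tendsto_zero] at hUl ⊢
  exact squeeze_zero (fun n => norm_nonneg _) (fun n => norm_abs_sub_abs _ _) hUl

/-- Submodularity of the Dirichlet energy. -/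
theorem exists_inf_sup (h : HasGrad u G) (h' : HasGrad w F) :
    ∃ A B, HasGrad (u ⊓ w) A ∧ HasGrad (u ⊔ w) B ∧ ‖A‖ ^ 2 + ‖B‖ ^ 2 ≤ ‖G‖ ^ 2 + ‖F‖ ^ 2 := by
  obtain ⟨D, hD, hle⟩ := (h'.sub h).exists_abs
  refine ⟨(2⁻¹ : ℝ) • (G + F - D), (2⁻¹ : ℝ) • (G + F + D), ?_, ?_, ?_⟩
  · rw [inf_eq_half_smul_add_sub_abs_sub ℝ]
    exact ((h.add h').sub hD).smul _
  · rw [sup_eq_half_smul_add_add_abs_sub ℝ]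
    exact ((h.add h').add hD).smul _
  -- The left side is (‖G + F‖² + ‖D‖²)/2 with ‖D‖ ≤ ‖F - G‖; a second parallelogram law finishes.
  · have p1 := parallelogram_law_with_norm ℝ (G + F) D
    have p2 := parallelogram_law_with_norm ℝ F G
    rw [add_comm F G] at p2
    simp only [norm_smul, mul_pow]
    norm_num
    nlinarith [norm_nonneg D]

end HasGrad

/-! ### Translation estimates -/

theorem sq_eLpNorm_two {α F : Type*} [MeasurableSpace α] [NormedAddCommGroup F] {μ : Measure α}
    (f : α → F) : eLpNorm f 2 μ ^ 2 = ∫⁻ x, ‖f x‖ₑ ^ 2 ∂μ := by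
  have := eLpNorm_nnreal_pow_eq_lintegral (f := f) (μ := μ) (p := 2) two_ne_zero
  simpa using this

theorem sq_enorm_Lp_two {α F : Type*} [MeasurableSpace α] [NormedAddCommGroup F] {μ : Measure α}
    (f : Lp F 2 μ) : ‖f‖ₑ ^ 2 = ∫⁻ x, ‖f x‖ₑ ^ 2 ∂μ := by
  rw [Lp.enorm_def, sq_eLpNorm_two]

/-- The Cauchy-Schwarz inequality against the constant function `1`. -/
theorem sq_lintegral_le {α : Type*} [MeasurableSpace α] {μ : Measure α} {f : α → ℝ≥0∞}
    (hf : AEMeasurable f μ) : (∫⁻ x, f x ∂μ) ^ 2 ≤ μ univ * ∫⁻ x, f x ^ 2 ∂μ := by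
  have h := ENNReal.lintegral_mul_le_Lp_mul_Lq μ Real.HolderConjugate.two_two hf
    (aemeasurable_const (b := (1 : ℝ≥0∞)))
  simp only [Pi.mul_apply, mul_one, ENNReal.one_rpow, lintegral_const, one_mul] at h
  have h2 := pow_le_pow_left₀ (zero_le) h 2
  rw [mul_pow, ← ENNReal.rpow_natCast, ← ENNReal.rpow_natCast, ← ENNReal.rpow_natCast,
    ← ENNReal.rpow_mul, ← ENNReal.rpow_mul] at h2
  norm_num at h2
  rw [mul_comm]
  exact_mod_cast h2

/-- Translations of test functions. -/
theorem IsTest.lintegral_translate_sub_le {φ : E N → ℝ} (h : IsTest φ) (y : E N) :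
    ∫⁻ x, ‖φ (x + y) - φ x‖ₑ ^ 2 ≤ ‖y‖ₑ ^ 2 * ∫⁻ x, ‖∇ φ x‖ₑ ^ 2 := by
  have hm : Measurable fun p : E N × ℝ => ‖∇ φ (p.1 + p.2 • y)‖ₑ ^ 2 :=
    (h.continuous_gradient.comp (by fun_prop : Continuous fun p : E N × ℝ =>
      p.1 + p.2 • y)).enorm.measurable.pow_const 2
  have hmx : ∀ x, Measurable fun t : ℝ => ‖∇ φ (x + t • y)‖ₑ ^ 2 := fun x =>
    (h.continuous_gradient.comp (by fun_prop : Continuous fun t : ℝ =>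
      x + t • y)).enorm.measurable.pow_const 2
  -- Fundamental theorem of calculus on the segment from x to x + y, then Cauchy–Schwarz in t.
  -- Tonelli and translation invariance later remove t.
  have key : ∀ x, ‖φ (x + y) - φ x‖ₑ ^ 2 ≤
      ‖y‖ₑ ^ 2 * ∫⁻ t in Icc (0 : ℝ) 1, ‖∇ φ (x + t • y)‖ₑ ^ 2 := by
    intro x
    let g : ℝ → ℝ := fun t => φ (x + t • y)
    have hg : ContDiff ℝ 1 g := (h.1.of_le (by simp)).comp (by fun_prop)
    have hd : ∀ t, ‖deriv g t‖ₑ ≤ ‖∇ φ (x + t • y)‖ₑ * ‖y‖ₑ := by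
      intro t
      have h1 : HasDerivAt (fun t : ℝ => x + t • y) y t := by
        simpa using ((hasDerivAt_id t).smul_const y).const_add x
      have h2 : HasDerivAt g (fderiv ℝ φ (x + t • y) y) t :=
        (h.differentiable _).hasFDerivAt.comp_hasDerivAt t h1
      rw [h2.deriv, ← ofReal_norm, ← ofReal_norm, ← ofReal_norm, norm_gradient,
        ← ENNReal.ofReal_mul (norm_nonneg _)]
      exact ENNReal.ofReal_le_ofReal (ContinuousLinearMap.le_opNorm _ _)
    have h1 := enorm_sub_le_lintegral_deriv_of_contDiffOn_Icc hg.contDiffOn (zero_le_one' ℝ)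
    have hg0 : g 1 - g 0 = φ (x + y) - φ x := by simp [g]
    rw [hg0] at h1
    calc ‖φ (x + y) - φ x‖ₑ ^ 2 ≤ (∫⁻ t in Icc (0 : ℝ) 1, ‖deriv g t‖ₑ) ^ 2 :=
          pow_le_pow_left₀ zero_le h1 2
      _ ≤ (volume.restrict (Icc (0 : ℝ) 1)) univ * ∫⁻ t in Icc (0 : ℝ) 1, ‖deriv g t‖ₑ ^ 2 :=
          sq_lintegral_le (hg.continuous_deriv le_rfl).enorm.measurable.aemeasurable
      _ ≤ ∫⁻ t in Icc (0 : ℝ) 1, ‖y‖ₑ ^ 2 * ‖∇ φ (x + t • y)‖ₑ ^ 2 := by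
          simp only [MeasurableSet.univ, Measure.restrict_apply, univ_inter, Real.volume_Icc,
            sub_zero, ENNReal.ofReal_one, one_mul]
          refine lintegral_mono fun t => ?_
          rw [← mul_pow, mul_comm]
          exact pow_le_pow_left₀ zero_le (hd t) 2
      _ = _ := lintegral_const_mul _ (hmx x)
  calc ∫⁻ x, ‖φ (x + y) - φ x‖ₑ ^ 2
      ≤ ∫⁻ x, ‖y‖ₑ ^ 2 * ∫⁻ t in Icc (0 : ℝ) 1, ‖∇ φ (x + t • y)‖ₑ ^ 2 := lintegral_mono key
    _ = ‖y‖ₑ ^ 2 * ∫⁻ x, ∫⁻ t in Icc (0 : ℝ) 1, ‖∇ φ (x + t • y)‖ₑ ^ 2 :=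
        lintegral_const_mul _ hm.lintegral_prod_right'
    _ = ‖y‖ₑ ^ 2 * ∫⁻ t in Icc (0 : ℝ) 1, ∫⁻ x, ‖∇ φ (x + t • y)‖ₑ ^ 2 := by
        rw [lintegral_lintegral_swap hm.aemeasurable]
    _ = _ := by
        congr 1
        simp only [fun z : E N => lintegral_add_right_eq_self (μ := (volume : Measure (E N)))
          (fun x => ‖∇ φ x‖ₑ ^ 2) z]
        simp

/-- Translations of functions in `W_0^{1,2}`. -/
theorem HasGrad.lintegral_translate_sub_le {u : L2 N} {G : L2Vec N} (h : HasGrad u G) (y : E N) :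
    ∫⁻ x, ‖u (x + y) - u x‖ₑ ^ 2 ≤ (‖y‖ₑ * ‖G‖ₑ) ^ 2 := by
  have hp : MeasurePreserving (fun x : E N => x + y) volume volume :=
    measurePreserving_add_right volume y
  -- Translation as an isometry of L² is continuous, so the estimate passes from test functions to
  -- u.
  let T : L2 N →ₗᵢ[ℝ] L2 N := Lp.compMeasurePreservingₗᵢ ℝ (fun x : E N => x + y) hp
  have hT : ∀ w : L2 N, T w =ᵐ[volume] fun x => w (x + y) := fun w =>
    Lp.coeFn_compMeasurePreserving w hp
  have hsub : ∀ w : L2 N, ‖T w - w‖ₑ ^ 2 = ∫⁻ x, ‖w (x + y) - w x‖ₑ ^ 2 := by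
    intro w
    rw [sq_enorm_Lp_two]
    refine lintegral_congr_ae ?_
    filter_upwards [Lp.coeFn_sub (T w) w, hT w] with x h1 h2
    rw [h1, Pi.sub_apply, h2]
  obtain ⟨φ, U, V, hφ, hU, hV, hUl, hVl⟩ := h.exists_tendsto
  have key : ∀ n, ‖T (U n) - U n‖ₑ ≤ ‖y‖ₑ * ‖V n‖ₑ := by
    intro n
    rw [← ENNReal.pow_le_pow_left_iff (n := 2) two_ne_zero, hsub, mul_pow, sq_enorm_Lp_two (V n)]
    convert (hφ n).lintegral_translate_sub_le y using 1
    · refine lintegral_congr_ae ?_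
      filter_upwards [hU n, hp.quasiMeasurePreserving.ae_eq_comp (hU n)] with x h1 h2
      simp only [Function.comp_apply] at h2
      rw [h1, h2]
    · congr 1
      refine lintegral_congr_ae ?_
      filter_upwards [hV n] with x h1
      rw [h1]
  rw [← hsub]
  refine pow_le_pow_left₀ zero_le ?_ 2
  have key' : ∀ n, ‖T (U n) - U n‖ ≤ ‖y‖ * ‖V n‖ := by
    intro n
    have := key n
    rwa [← ofReal_norm, ← ofReal_norm, ← ofReal_norm, ← ENNReal.ofReal_mul (norm_nonneg _),
      ENNReal.ofReal_le_ofReal_iff (by positivity)] at this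
  have hlim : ‖T u - u‖ ≤ ‖y‖ * ‖G‖ :=
    le_of_tendsto_of_tendsto' (((T.continuous.tendsto u).comp hUl).sub hUl).norm
      (hVl.norm.const_mul _) key'
  rw [← ofReal_norm, ← ofReal_norm, ← ofReal_norm, ← ENNReal.ofReal_mul (norm_nonneg _)]
  exact ENNReal.ofReal_le_ofReal hlim

/-! ### Ball averages -/

/-- The uniform probability measure on the ball of radius `R` about the origin. -/
def ballMeasure (N : ℕ) (R : ℝ) : Measure (E N) :=
  ProbabilityTheory.cond volume (Metric.ball (0 : E N) R)

theorem isProbabilityMeasure_ballMeasure {R : ℝ} (hR : 0 < R) :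
    IsProbabilityMeasure (ballMeasure N R) :=
  ProbabilityTheory.cond_isProbabilityMeasure_of_finite (Metric.measure_ball_pos volume 0 hR).ne'
    measure_ball_lt_top.ne

/-- The average of `u` over the ball of radius `R` about `x`. -/
def ballAvg (R : ℝ) (u : E N → ℝ) (x : E N) : ℝ := ∫ y, u (x + y) ∂ballMeasure N R

theorem ballAvg_eq (R : ℝ) (u : E N → ℝ) (x : E N) :
    ballAvg R u x = (volume.real (Metric.ball (0 : E N) R))⁻¹ * ∫ y in Metric.ball x R, u y := by
  rw [ballAvg, ballMeasure, ProbabilityTheory.cond, integral_smul_measure, ENNReal.toReal_inv,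
    smul_eq_mul, Measure.real]
  congr 1
  have hp : MeasurePreserving (fun y : E N => x + y) volume volume :=
    measurePreserving_add_left volume x
  have he : MeasurableEmbedding (fun y : E N => x + y) := measurableEmbedding_addLeft x
  rw [← hp.setIntegral_preimage_emb he u (Metric.ball x R)]
  congr 2
  ext y
  simp [dist_eq_norm]

theorem measurable_ballAvg {R : ℝ} (hR : 0 < R) (u : L2 N) : Measurable (ballAvg R u) := by
  have := isProbabilityMeasure_ballMeasure (N := N) hR
  have h : StronglyMeasurable fun p : E N × E N => u (p.1 + p.2) :=
    (Lp.stronglyMeasurable u).comp_measurable (by fun_prop)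
  exact h.integral_prod_right.measurable

theorem integrable_translate_ballMeasure {R : ℝ} (u : L2 N) (x : E N) :
    Integrable (fun y => u (x + y)) (ballMeasure N R) := by
  have hp : MeasurePreserving (fun y : E N => x + y) volume volume :=
    measurePreserving_add_left volume x
  have h1 : MemLp (fun y => u (x + y)) 2 volume := (Lp.memLp u).comp_measurePreserving hp
  rcases eq_or_ne (volume (Metric.ball (0 : E N) R)) 0 with h0 | h0
  · simp [ballMeasure, ProbabilityTheory.cond, Measure.restrict_eq_zero.2 h0]
  refine Integrable.smul_measure ?_ (ENNReal.inv_ne_top.2 h0)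
  have : IsFiniteMeasure (volume.restrict (Metric.ball (0 : E N) R)) :=
    ⟨by simpa using measure_ball_lt_top⟩
  exact (h1.restrict _).integrable one_le_two

/-- A function in `W_0^{1,2}` is `L²`-close to its averages over balls. -/
theorem HasGrad.lintegral_sub_ballAvg_le {u : L2 N} {G : L2Vec N} (h : HasGrad u G) {R : ℝ}
    (hR : 0 < R) : ∫⁻ x, ‖u x - ballAvg R u x‖ₑ ^ 2 ≤ (ENNReal.ofReal R * ‖G‖ₑ) ^ 2 := by
  have := isProbabilityMeasure_ballMeasure (N := N) hR
  have hum : Measurable u := (Lp.stronglyMeasurable u).measurable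
  have hm : Measurable fun p : E N × E N => ‖u (p.1 + p.2) - u p.1‖ₑ ^ 2 := by fun_prop
  -- The difference is a mean of translation differences, and for a probability measure the square
  -- of a mean is at most the mean of the squares.
  have key : ∀ x, ‖u x - ballAvg R u x‖ₑ ^ 2 ≤
      ∫⁻ y, ‖u (x + y) - u x‖ₑ ^ 2 ∂ballMeasure N R := by
    intro x
    have e : u x - ballAvg R u x = -∫ y, (u (x + y) - u x) ∂ballMeasure N R := by
      rw [integral_sub (integrable_translate_ballMeasure u x) (integrable_const _), ballAvg]
      simp
    rw [e, enorm_neg]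
    calc _ ≤ (∫⁻ y, ‖u (x + y) - u x‖ₑ ∂ballMeasure N R) ^ 2 :=
          pow_le_pow_left₀ zero_le (enorm_integral_le_lintegral_enorm _) 2
      _ ≤ _ := by
          refine (sq_lintegral_le (by fun_prop)).trans ?_
          rw [measure_univ, one_mul]
  calc _ ≤ ∫⁻ x, ∫⁻ y, ‖u (x + y) - u x‖ₑ ^ 2 ∂ballMeasure N R := lintegral_mono key
    _ = ∫⁻ y, (∫⁻ x, ‖u (x + y) - u x‖ₑ ^ 2) ∂ballMeasure N R :=
        lintegral_lintegral_swap hm.aemeasurable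
    _ ≤ ∫⁻ y, (ENNReal.ofReal R * ‖G‖ₑ) ^ 2 ∂ballMeasure N R := by
        refine lintegral_mono_ae ?_
        filter_upwards [ProbabilityTheory.ae_cond_mem (μ := (volume : Measure (E N)))
          (s := Metric.ball 0 R) measurableSet_ball] with y hy
        refine (h.lintegral_translate_sub_le y).trans (pow_le_pow_left₀ zero_le ?_ 2)
        gcongr
        rw [← ofReal_norm]
        exact ENNReal.ofReal_le_ofReal (mem_ball_zero_iff.1 hy).le
    _ = _ := by simp

theorem HasGrad.memLp_sub_ballAvg {u : L2 N} {G : L2Vec N} (h : HasGrad u G) {R : ℝ}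
    (hR : 0 < R) : ∃ hm : MemLp (fun x => u x - ballAvg R u x) 2 volume,
      ‖hm.toLp _‖ ≤ R * ‖G‖ := by
  have hm : Measurable fun x => u x - ballAvg R u x :=
    (Lp.stronglyMeasurable u).measurable.sub (measurable_ballAvg hR u)
  have hle : eLpNorm (fun x => u x - ballAvg R u x) 2 volume ≤ ENNReal.ofReal (R * ‖G‖) := by
    rw [← ENNReal.pow_le_pow_left_iff (n := 2) two_ne_zero, sq_eLpNorm_two,
      ENNReal.ofReal_mul hR.le, ofReal_norm]
    exact h.lintegral_sub_ballAvg_le hR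
  have hm2 : MemLp (fun x => u x - ballAvg R u x) 2 volume :=
    ⟨hm.aestronglyMeasurable, hle.trans_lt ENNReal.ofReal_lt_top⟩
  refine ⟨hm2, ?_⟩
  rw [Lp.norm_toLp]
  exact ENNReal.toReal_le_of_le_ofReal (by positivity) hle

/-- In this form the average at a fixed point is visibly continuous under weak convergence. -/
theorem ballAvg_eq_inner (R : ℝ) (u : L2 N) (x : E N) :
    ballAvg R u x = (volume.real (Metric.ball (0 : E N) R))⁻¹ *
      inner ℝ u (indicatorConstLp 2 (measurableSet_ball (x := x) (ε := R))
        measure_ball_lt_top.ne (1 : ℝ)) := by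
  rw [ballAvg_eq, real_inner_comm, L2.inner_indicatorConstLp_one]

theorem volume_real_ball (x : E N) (R : ℝ) :
    volume.real (Metric.ball x R) = volume.real (Metric.ball (0 : E N) R) := by
  rw [Measure.real, Measure.real, Measure.addHaar_ball_center]

/-- Cauchy–Schwarz: the bound is |B_R|^(-1/2) ‖u‖, uniform in x and small for large balls. -/
theorem abs_ballAvg_le {R : ℝ} (u : L2 N) (x : E N) :
    |ballAvg R u x| ≤ (volume.real (Metric.ball (0 : E N) R))⁻¹ *
      (‖u‖ * volume.real (Metric.ball (0 : E N) R) ^ (1 / 2 : ℝ)) := by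
  rw [ballAvg_eq_inner, abs_mul, abs_of_nonneg (inv_nonneg.2 measureReal_nonneg)]
  gcongr
  refine (abs_real_inner_le_norm _ _).trans ?_
  rw [norm_indicatorConstLp (by norm_num) (by norm_num), volume_real_ball]
  simp

/-- Volume scales as R^N; for N = 0 all these balls would have the same volume. -/
theorem tendsto_volume_real_ball (hN : 1 ≤ N) :
    Tendsto (fun n : ℕ => volume.real (Metric.ball (0 : E N) ((n : ℝ) + 1))) atTop atTop := by
  have h1 : 0 < volume.real (Metric.ball (0 : E N) 1) :=
    ENNReal.toReal_pos (Metric.measure_ball_pos volume 0 one_pos).ne' measure_ball_lt_top.ne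
  refine tendsto_atTop_mono (f := fun n : ℕ => (n : ℝ) * volume.real (Metric.ball (0 : E N) 1)) ?_
    (tendsto_natCast_atTop_atTop.atTop_mul_const h1)
  intro n
  rw [Measure.real, Measure.real, Measure.addHaar_ball_of_pos volume (0 : E N) (r := (n : ℝ) + 1)
    (by positivity), ENNReal.toReal_mul,
    ENNReal.toReal_ofReal (by positivity), finrank_euclideanSpace_fin]
  refine mul_le_mul_of_nonneg_right ?_ ENNReal.toReal_nonneg
  calc (n : ℝ) ≤ (n + 1) ^ 1 := by linarith
    _ ≤ (n + 1) ^ N := pow_le_pow_right₀ (by linarith [Nat.cast_nonneg (α := ℝ) n]) hN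

/-- The only function in `W_0^{1,2}` with zero gradient is zero. -/
theorem HasGrad.eq_zero (hN : 1 ≤ N) {u : L2 N} (h : HasGrad u 0) : u = 0 := by
  -- With zero gradient u equals its averages at every radius, and these tend to 0 as the radius
  -- grows.
  have h1 : ∀ n : ℕ, ∀ᵐ x, u x = ballAvg (n + 1) u x := by
    intro n
    have h0 := h.lintegral_sub_ballAvg_le (R := n + 1) (by positivity)
    have hm : Measurable fun x => ‖u x - ballAvg (n + 1) u x‖ₑ ^ 2 :=
      ((Lp.stronglyMeasurable u).measurable.sub (measurable_ballAvg (by positivity) u)).enorm.pow_const 2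
    simp only [enorm_zero, mul_zero, ne_eq, OfNat.ofNat_ne_zero, not_false_eq_true, zero_pow,
      nonpos_iff_eq_zero] at h0
    filter_upwards [(lintegral_eq_zero_iff hm).1 h0] with x hx
    simpa [sub_eq_zero] using hx
  rw [Lp.eq_zero_iff_ae_eq_zero]
  filter_upwards [ae_all_iff.2 h1] with x hx
  have hlim : Tendsto (fun n : ℕ => (volume.real (Metric.ball (0 : E N) ((n : ℝ) + 1)))⁻¹ *
      (‖u‖ * volume.real (Metric.ball (0 : E N) ((n : ℝ) + 1)) ^ (1 / 2 : ℝ))) atTop (𝓝 0) := by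
    have h2 := ((tendsto_rpow_neg_atTop (y := 1 / 2) (by norm_num)).comp
      (tendsto_volume_real_ball hN)).const_mul ‖u‖
    rw [mul_zero] at h2
    refine h2.congr fun n => ?_
    have hpos : 0 < volume.real (Metric.ball (0 : E N) ((n : ℝ) + 1)) :=
      ENNReal.toReal_pos (Metric.measure_ball_pos volume 0 (by positivity)).ne'
        measure_ball_lt_top.ne
    simp only [Function.comp_apply]
    rw [← Real.rpow_neg_one, mul_left_comm, ← Real.rpow_add hpos]
    norm_num
  have h3 : |u x| ≤ 0 := ge_of_tendsto' hlim fun n => by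
    rw [hx n]
    exact abs_ballAvg_le u x
  simpa using h3

/-! ### Compactness -/

/-- A positive integrable weight bounded by `1`. -/
theorem exists_weight (N : ℕ) : ∃ ρ : E N → ℝ, Measurable ρ ∧ Integrable ρ ∧ MemLp ρ 2 volume ∧
    ∀ x, 0 < ρ x := by
  let ρ : E N → ℝ := fun x => (1 + ‖x‖) ^ (-((N : ℝ) + 1))
  have hpos : ∀ x, 0 < ρ x := fun x => by positivity
  have hm : Measurable ρ := by fun_prop
  have hi : Integrable ρ := by
    refine integrable_one_add_norm ?_
    rw [finrank_euclideanSpace_fin]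
    linarith
  refine ⟨ρ, hm, hi, ?_, hpos⟩
  rw [memLp_two_iff_integrable_sq hm.aestronglyMeasurable]
  refine hi.mono' (hm.pow_const 2).aestronglyMeasurable (ae_of_all _ fun x => ?_)
  have h1 : ρ x ≤ 1 :=
    Real.rpow_le_one_of_one_le_of_nonpos (by linarith [norm_nonneg x]) (by
      have : (0 : ℝ) ≤ N := Nat.cast_nonneg N
      linarith)
  rw [Real.norm_of_nonneg (by positivity)]
  nlinarith [hpos x]

/-- Compactness: a bounded sequence in `W_0^{1,2}` that converges weakly to zero has a subsequence
converging to zero almost everywhere. -/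
theorem HasGrad.exists_ae_subseq_zero {w : ℕ → L2 N} {G : ℕ → L2Vec N} {C D : ℝ}
    (h : ∀ n, HasGrad (w n) (G n)) (hw : ∀ n, ‖w n‖ ≤ C) (hG : ∀ n, ‖G n‖ ≤ D)
    (hweak : ∀ y, Tendsto (fun n => inner ℝ (w n) y) atTop (𝓝 0)) :
    ∃ s : ℕ → ℕ, StrictMono s ∧ ∀ᵐ x, Tendsto (fun n => w (s n) x) atTop (𝓝 0) := by
  obtain ⟨ρ, hρm, hρi, hρ2, hρ⟩ := exists_weight N
  have hD : 0 ≤ D := (norm_nonneg _).trans (hG 0)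
  have hC : 0 ≤ C := (norm_nonneg _).trans (hw 0)
  -- For fixed R, weak convergence makes the averages tend to 0 at every point; they are uniformly
  -- bounded, and the integrable weight ρ allows dominated convergence.
  have havg : ∀ R : ℝ, 0 < R →
      Tendsto (fun n => ∫ x, ρ x * |ballAvg R (w n) x|) atTop (𝓝 0) := by
    intro R hR
    set κ := volume.real (Metric.ball (0 : E N) R)
    have := tendsto_integral_of_dominated_convergence (μ := (volume : Measure (E N)))
      (F := fun n x => ρ x * |ballAvg R (w n) x|) (f := fun _ => (0 : ℝ))
      (fun x => ρ x * (κ⁻¹ * (C * κ ^ (1 / 2 : ℝ))))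
      (fun n => (hρm.mul (measurable_ballAvg hR (w n)).abs).aestronglyMeasurable)
      (hρi.mul_const _)
      (fun n => ae_of_all _ fun x => by
        rw [norm_mul, Real.norm_of_nonneg (hρ x).le, Real.norm_eq_abs, abs_abs]
        refine mul_le_mul_of_nonneg_left ((abs_ballAvg_le _ _).trans ?_) (hρ x).le
        gcongr
        exact hw n)
      (ae_of_all _ fun x => by
        have h1 := (hweak (indicatorConstLp 2 (measurableSet_ball (x := x) (ε := R))
          measure_ball_lt_top.ne (1 : ℝ))).const_mul κ⁻¹
        rw [mul_zero] at h1
        simpa [ballAvg_eq_inner] using (h1.abs).const_mul (ρ x))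
    simpa using this
  have hint : ∀ n, Integrable fun x => ρ x * |w n x| := fun n =>
    hρ2.integrable_mul (Lp.memLp (w n)).abs
  have hbound : ∀ R : ℝ, 0 < R → ∀ n, ∫ x, ρ x * |w n x| ≤
      ‖hρ2.toLp ρ‖ * (R * D) + ∫ x, ρ x * |ballAvg R (w n) x| := by
    intro R hR n
    obtain ⟨hm, hle⟩ := (h n).memLp_sub_ballAvg hR
    have i1 : Integrable fun x => ρ x * |w n x - ballAvg R (w n) x| := hρ2.integrable_mul hm.abs
    have i2 : Integrable fun x => ρ x * |ballAvg R (w n) x| := by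
      refine ((hint n).add i1).mono'
        (hρm.mul (measurable_ballAvg hR (w n)).abs).aestronglyMeasurable (ae_of_all _ fun x => ?_)
      rw [norm_mul, Real.norm_of_nonneg (hρ x).le, Real.norm_eq_abs, abs_abs, Pi.add_apply,
        ← mul_add]
      refine mul_le_mul_of_nonneg_left ?_ (hρ x).le
      have := abs_sub (w n x) (w n x - ballAvg R (w n) x)
      rwa [sub_sub_cancel] at this
    have h1 : ∫ x, ρ x * |w n x - ballAvg R (w n) x| ≤ ‖hρ2.toLp ρ‖ * (R * D) := by
      have e : ∫ x, ρ x * |w n x - ballAvg R (w n) x| = inner ℝ (hρ2.toLp ρ) |hm.toLp _| := by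
        rw [L2.inner_def]
        refine integral_congr_ae ?_
        filter_upwards [hρ2.coeFn_toLp, hm.coeFn_toLp, Lp.coeFn_abs (hm.toLp _)] with x h1 h2 h3
        simp [h1, h2, h3, mul_comm]
      rw [e]
      refine (real_inner_le_norm _ _).trans ?_
      rw [norm_abs_eq_norm]
      gcongr
      exact hle.trans (by gcongr; exact hG n)
    calc ∫ x, ρ x * |w n x|
        ≤ ∫ x, (ρ x * |w n x - ballAvg R (w n) x| + ρ x * |ballAvg R (w n) x|) := by
          refine integral_mono (hint n) (i1.add i2) fun x => ?_
          simp only [← mul_add]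
          refine mul_le_mul_of_nonneg_left ?_ (hρ x).le
          have := abs_add_le (w n x - ballAvg R (w n) x) (ballAvg R (w n) x)
          rwa [sub_add_cancel] at this
      _ = _ := integral_add i1 i2
      _ ≤ _ := by gcongr
  have hlim : Tendsto (fun n => ∫ x, ρ x * |w n x|) atTop (𝓝 0) := by
    have h0 : ∀ n, 0 ≤ ∫ x, ρ x * |w n x| := fun n =>
      integral_nonneg fun x => mul_nonneg (hρ x).le (abs_nonneg _)
    rw [Metric.tendsto_atTop]
    intro ε hε
    set B := ‖hρ2.toLp ρ‖ * D
    have hB : 0 ≤ B := by positivity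
    -- This radius makes the gradient term at most ε/2; the `+ 1` covers B = 0. Only then is n taken
    -- large.
    have hR : 0 < ε / (2 * (B + 1)) := by positivity
    obtain ⟨n0, hn0⟩ := Metric.tendsto_atTop.1 (havg _ hR) (ε / 2) (by positivity)
    refine ⟨n0, fun n hn => ?_⟩
    have h1 := hn0 n hn
    rw [dist_zero_right, Real.norm_eq_abs] at h1 ⊢
    rw [abs_of_nonneg (h0 n)]
    have h2 := hbound _ hR n
    have h3 : ‖hρ2.toLp ρ‖ * (ε / (2 * (B + 1)) * D) ≤ ε / 2 := by
      rw [show ‖hρ2.toLp ρ‖ * (ε / (2 * (B + 1)) * D) = ε / 2 * (B / (B + 1)) by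
        simp only [B]; field_simp]
      exact mul_le_of_le_one_right (by positivity) ((div_le_one (by positivity)).2 (by linarith))
    linarith [le_abs_self (∫ x, ρ x * |ballAvg (ε / (2 * (B + 1))) (w n) x|)]
  have hmeas : TendstoInMeasure (volume : Measure (E N)) (fun n x => ρ x * |w n x|) atTop
      (fun _ => 0) := by
    refine tendstoInMeasure_of_tendsto_eLpNorm one_ne_zero
      (fun n => (hint n).aestronglyMeasurable) aestronglyMeasurable_const ?_
    have h1 := ENNReal.tendsto_ofReal hlim
    rw [ENNReal.ofReal_zero] at h1
    refine h1.congr fun n => ?_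
    rw [eLpNorm_one_eq_lintegral_enorm, ofReal_integral_eq_lintegral_ofReal (hint n)
      (ae_of_all _ fun x => mul_nonneg (hρ x).le (abs_nonneg _))]
    refine lintegral_congr fun x => ?_
    simp only [Pi.sub_apply, sub_zero]
    rw [← ofReal_norm, Real.norm_of_nonneg (mul_nonneg (hρ x).le (abs_nonneg _))]
  obtain ⟨s, hs, hae⟩ := hmeas.exists_seq_tendsto_ae
  refine ⟨s, hs, ?_⟩
  filter_upwards [hae] with x hx
  have h1 := hx.const_mul (ρ x)⁻¹
  rw [mul_zero] at h1
  rw [tendsto_zero_iff_abs_tendsto_zero]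
  refine h1.congr fun n => ?_
  simp [(hρ x).ne']

/-- Bounded sequences in `W_0^{1,2}` have subsequences that converge weakly together with their
gradients, and almost everywhere. -/
theorem HasGrad.exists_subseq {u : ℕ → L2 N} {G : ℕ → L2Vec N} {C D : ℝ}
    (h : ∀ n, HasGrad (u n) (G n)) (hu : ∀ n, ‖u n‖ ≤ C) (hG : ∀ n, ‖G n‖ ≤ D) :
    ∃ (s : ℕ → ℕ), StrictMono s ∧ ∃ (z : L2 N) (F : L2Vec N), HasGrad z F ∧
      (∀ y, Tendsto (fun n => inner ℝ (u (s n)) y) atTop (𝓝 (inner ℝ z y))) ∧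
      (∀ y, Tendsto (fun n => inner ℝ (G (s n)) y) atTop (𝓝 (inner ℝ F y))) ∧
      ∀ᵐ x, Tendsto (fun n => u (s n) x) atTop (𝓝 (z x)) := by
  obtain ⟨z, F, s, hs, hF, h1, h2⟩ := HasGrad.exists_weak_subseq h hu hG
  obtain ⟨t, ht, hae⟩ := HasGrad.exists_ae_subseq_zero (w := fun n => u (s n) - z)
    (G := fun n => G (s n) - F) (C := C + ‖z‖) (D := D + ‖F‖)
    (fun n => (h (s n)).sub hF)
    (fun n => (norm_sub_le _ _).trans (by gcongr; exact hu _))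
    (fun n => (norm_sub_le _ _).trans (by gcongr; exact hG _))
    (fun y => by
      have := (h1 y).sub_const (inner ℝ z y)
      rw [sub_self] at this
      exact this.congr fun n => (inner_sub_left _ _ _).symm)
  refine ⟨s ∘ t, hs.comp ht, z, F, hF, fun y => (h1 y).comp ht.tendsto_atTop,
    fun y => (h2 y).comp ht.tendsto_atTop, ?_⟩
  filter_upwards [hae, ae_all_iff.2 fun n => Lp.coeFn_sub (u (s (t n))) z] with x hx hsub
  have := hx.add_const (z x)
  rw [zero_add] at this
  refine this.congr fun n => ?_
  rw [hsub n, Pi.sub_apply, sub_add_cancel]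
  rfl

/-- Simultaneous extraction of subsequences for finitely many properties. -/
theorem exists_common_subseq {ι : Type*} [Fintype ι] (P : ι → (ℕ → ℕ) → Prop)
    (hmono : ∀ i (s t : ℕ → ℕ), P i s → StrictMono t → P i (s ∘ t))
    (hex : ∀ i (s : ℕ → ℕ), StrictMono s → ∃ t : ℕ → ℕ, StrictMono t ∧ P i (s ∘ t)) :
    ∃ s, StrictMono s ∧ ∀ i, P i s := by
  classical
  suffices H : ∀ A : Finset ι, ∃ s, StrictMono s ∧ ∀ i ∈ A, P i s by
    obtain ⟨s, hs, h⟩ := H Finset.univ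
    exact ⟨s, hs, fun i => h i (Finset.mem_univ i)⟩
  intro A
  induction A using Finset.induction_on with
  | empty => exact ⟨id, strictMono_id, by simp⟩
  | insert a A _ ih =>
    obtain ⟨s, hs, h⟩ := ih
    obtain ⟨t, ht, hP⟩ := hex a s hs
    refine ⟨s ∘ t, hs.comp ht, fun i hi => ?_⟩
    rcases Finset.mem_insert.1 hi with rfl | hi
    · exact hP
    · exact hmono i s t (h i hi) ht

/-! ### Scalar energy and its finiteness -/

/-- `f` is bounded by `M` and at most `-c` outside the set `D` of finite measure. -/
structure Tame (f : E N → ℝ) (D : Set (E N)) (M c : ℝ) : Prop where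
  aesm : AEStronglyMeasurable f volume
  measurableSet : MeasurableSet D
  measure_ne_top : volume D ≠ ⊤
  pos : 0 < c
  bound : ∀ᵐ x, |f x| ≤ M
  le_neg : ∀ᵐ x, x ∉ D → f x ≤ -c

theorem ConditionA.exists_tame {f : E N → ℝ} (hf : ConditionA f) :
    ∃ (D : Set (E N)) (M c : ℝ), IsCompact D ∧ 0 < M ∧ Tame f D M c := by
  obtain ⟨hb, -, C, hC, c, hc, hle⟩ := hf
  -- The `+ 1` makes the bound strictly positive even when f = 0.
  refine ⟨C, (eLpNorm f ∞ volume).toReal + 1, -c, hC, by positivity, hb.1, hC.measurableSet,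
    hC.measure_lt_top.ne, by linarith, ?_, by simpa using hle⟩
  have h1 := hb.2.ne
  rw [eLpNorm_exponent_top] at h1 ⊢
  filter_upwards [ae_le_eLpNormEssSup (f := f) (μ := volume)] with x hx
  have := ENNReal.toReal_mono h1 hx
  rw [toReal_enorm, Real.norm_eq_abs] at this
  linarith

/-- The class of nonnegative integrable functions in `W_0^{1,2}`. -/
structure Adm (u : L2 N) : Prop where
  hasGrad : HasGrad u (weakGrad u)
  nonneg : ∀ᵐ x, 0 ≤ u x
  integrable : Integrable u volume

/-- The real-valued energy. -/
def energy (f : E N → ℝ) (u : L2 N) : ℝ := 1 / 2 * ‖weakGrad u‖ ^ 2 - ∫ x, f x * u x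

theorem sq_norm_Lp_two {F : Type*} [NormedAddCommGroup F] [InnerProductSpace ℝ F]
    (G : Lp F 2 (volume : Measure (E N))) : ‖G‖ ^ 2 = ∫ x, ‖G x‖ ^ 2 := by
  rw [← real_inner_self_eq_norm_sq, L2.inner_def]
  simp

theorem integrable_sq_norm_Lp_two {F : Type*} [NormedAddCommGroup F] [InnerProductSpace ℝ F]
    (G : Lp F 2 (volume : Measure (E N))) : Integrable fun x => ‖G x‖ ^ 2 := by
  simpa using L2.integrable_inner (𝕜 := ℝ) G G

theorem extIntegral_of_integrable {g : E N → ℝ} (hg : Integrable g) :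
    extIntegral g = ((∫ x, g x : ℝ) : EReal) := by
  have h1 : ∫⁻ x, ENNReal.ofReal (g x) ≠ ⊤ := hg.lintegral_lt_top.ne
  have h2 : ∫⁻ x, ENNReal.ofReal (-g x) ≠ ⊤ := hg.neg.lintegral_lt_top.ne
  rw [integral_eq_lintegral_pos_part_sub_lintegral_neg_part hg, EReal.coe_sub, extIntegral,
    EReal.coe_ennreal_toReal h1, EReal.coe_ennreal_toReal h2]

namespace Tame

variable {f : E N → ℝ} {D : Set (E N)} {M c : ℝ}

theorem integrable_mul (hf : Tame f D M c) {u : L2 N} (hu : Integrable u volume) :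
    Integrable fun x => f x * u x :=
  hu.bdd_mul hf.aesm (by filter_upwards [hf.bound] with x hx using hx)

theorem extIntegral_eq (hf : Tame f D M c) {u : L2 N} (hu : Integrable u volume) :
    extIntegral (fun x => (1 / 2 : ℝ) * ‖weakGrad u x‖ ^ 2 - f x * u x) = energy f u := by
  have i1 : Integrable fun x => (1 / 2 : ℝ) * ‖weakGrad u x‖ ^ 2 :=
    (integrable_sq_norm_Lp_two _).const_mul _
  have i2 : Integrable fun x => (1 / 2 : ℝ) * ‖weakGrad u x‖ ^ 2 - f x * u x :=
    i1.sub (hf.integrable_mul hu)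
  rw [extIntegral_of_integrable i2, integral_sub i1 (hf.integrable_mul hu), integral_const_mul, energy,
    sq_norm_Lp_two]

theorem integrable_indicator (hf : Tame f D M c) (u : L2 N) :
    Integrable (D.indicator u) volume := by
  rw [integrable_indicator_iff hf.measurableSet]
  have : IsFiniteMeasure (volume.restrict D) := ⟨by simpa using hf.measure_ne_top.lt_top⟩
  exact ((Lp.memLp u).restrict D).integrable one_le_two

/-- The key pointwise bound. -/
theorem ae_mul_le (hf : Tame f D M c) {u : L2 N} (hu : ∀ᵐ x, 0 ≤ u x) :
    ∀ᵐ x, f x * u x ≤ (M + c) * D.indicator u x - c * u x := by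
  filter_upwards [hu, hf.bound, hf.le_neg] with x h0 h1 h2
  by_cases hx : x ∈ D
  · rw [indicator_of_mem hx]
    nlinarith [le_abs_self (f x)]
  · rw [indicator_of_notMem hx]
    nlinarith [h2 hx]

/-- The negative part is dominated by (M + c) 1_D u, integrable because D has finite measure. Since
c u ≤ (M + c) 1_D u - f u, a finite positive part would make u integrable. -/
theorem extIntegral_eq_top (hf : Tame f D M c) {u : L2 N} (hu : ∀ᵐ x, 0 ≤ u x)
    (hi : ¬ Integrable u volume) :
    extIntegral (fun x => (1 / 2 : ℝ) * ‖weakGrad u x‖ ^ 2 - f x * u x) = ⊤ := by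
  set g : E N → ℝ := fun x => (1 / 2 : ℝ) * ‖weakGrad u x‖ ^ 2 - f x * u x
  have i1 : Integrable fun x => (1 / 2 : ℝ) * ‖weakGrad u x‖ ^ 2 :=
    (integrable_sq_norm_Lp_two _).const_mul _
  have husm : AEStronglyMeasurable u volume := (Lp.stronglyMeasurable u).aestronglyMeasurable
  have hgm : AEStronglyMeasurable g volume := i1.aestronglyMeasurable.sub (hf.aesm.mul husm)
  have hneg : ∫⁻ x, ENNReal.ofReal (-g x) ≠ ⊤ := by
    have hb := ((hf.integrable_indicator u).const_mul (M + c)).lintegral_lt_top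
    refine (lt_of_le_of_lt (lintegral_mono_ae ?_) hb).ne
    filter_upwards [hf.ae_mul_le hu, hu] with x h1 h2
    refine ENNReal.ofReal_le_ofReal ?_
    have : 0 ≤ ‖weakGrad u x‖ ^ 2 := by positivity
    simp only [g]
    nlinarith [hf.pos]
  have hpos : ∫⁻ x, ENNReal.ofReal (g x) = ⊤ := by
    by_contra hfin
    refine hi ?_
    have hg : Integrable g := by
      refine ⟨hgm, ?_⟩
      rw [hasFiniteIntegral_iff_enorm]
      refine lt_of_le_of_lt (lintegral_mono (g := fun x => ENNReal.ofReal (g x) +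
        ENNReal.ofReal (-g x)) fun x => ?_) ?_
      · rw [← ofReal_norm, Real.norm_eq_abs]
        rcases le_total 0 (g x) with h | h
        · rw [abs_of_nonneg h]; exact le_self_add
        · rw [abs_of_nonpos h]; exact le_add_self
      · rw [lintegral_add_left' hgm.aemeasurable.ennreal_ofReal]
        exact ENNReal.add_lt_top.2 ⟨lt_top_iff_ne_top.2 hfin, lt_top_iff_ne_top.2 hneg⟩
    have h1 : Integrable fun x => c⁻¹ * ((M + c) * D.indicator u x - (f x * u x)) := by
      refine (((hf.integrable_indicator u).const_mul _).sub ((i1.sub hg).congr ?_)).const_mul _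
      exact ae_of_all _ fun x => by simp [g]
    refine h1.mono' husm ?_
    filter_upwards [hf.ae_mul_le hu, hu] with x h2 h3
    rw [Real.norm_of_nonneg h3, inv_mul_eq_div, le_div_iff₀ hf.pos]
    linarith
  rw [extIntegral, hpos, EReal.coe_ennreal_top]
  lift (∫⁻ x, ENNReal.ofReal (-g x)) to NNReal using hneg with r
  exact EReal.top_sub_coe r

theorem mul_sub_le_energy (hf : Tame f D M c) {u : L2 N} (hu : Adm u) :
    1 / 2 * ‖weakGrad u‖ ^ 2 + c * (∫ x, u x) - (M + c) * ∫ x in D, u x ≤ energy f u := by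
  have h1 : ∫ x, f x * u x ≤ (M + c) * (∫ x in D, u x) - c * ∫ x, u x := by
    rw [← integral_indicator hf.measurableSet, ← integral_const_mul, ← integral_const_mul,
      ← integral_sub ((hf.integrable_indicator u).const_mul _) (hu.integrable.const_mul _)]
    exact integral_mono_ae (hf.integrable_mul hu.integrable)
      (((hf.integrable_indicator u).const_mul _).sub (hu.integrable.const_mul _))
      (hf.ae_mul_le hu.nonneg)
  rw [energy]
  linarith

end Tame

/-! ### Coercivity -/

theorem ballAvg_le_of_integrable {u : L2 N} (hu : Adm u) (R : ℝ) (x : E N) :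
    0 ≤ ballAvg R u x ∧
      ballAvg R u x ≤ (volume.real (Metric.ball (0 : E N) R))⁻¹ * ∫ y, u y := by
  rw [ballAvg_eq]
  refine ⟨mul_nonneg (inv_nonneg.2 measureReal_nonneg)
    (integral_nonneg_of_ae (ae_restrict_of_ae hu.nonneg)), ?_⟩
  exact mul_le_mul_of_nonneg_left (setIntegral_le_integral hu.integrable hu.nonneg)
    (inv_nonneg.2 measureReal_nonneg)

/-- Split u into u - avg_R u and avg_R u: the first costs R times the gradient norm, the second a
multiple of ∫ u that can be made small by taking R large. -/
theorem Adm.setIntegral_le {u : L2 N} (hu : Adm u) {D : Set (E N)} (hD : MeasurableSet D)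
    (hD' : volume D ≠ ⊤) {R : ℝ} (hR : 0 < R) :
    ∫ x in D, u x ≤ ‖indicatorConstLp 2 hD hD' (1 : ℝ)‖ * (R * ‖weakGrad u‖) +
      volume.real D * ((volume.real (Metric.ball (0 : E N) R))⁻¹ * ∫ y, u y) := by
  obtain ⟨hm, hle⟩ := hu.hasGrad.memLp_sub_ballAvg hR
  have : IsFiniteMeasure (volume.restrict D) := ⟨by simpa using hD'.lt_top⟩
  set κ := (volume.real (Metric.ball (0 : E N) R))⁻¹ * ∫ y, u y
  have h1 : ∫ x in D, (u x - ballAvg R u x) ≤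
      ‖indicatorConstLp 2 hD hD' (1 : ℝ)‖ * (R * ‖weakGrad u‖) := by
    have e : ∫ x in D, (u x - ballAvg R u x) =
        inner ℝ (indicatorConstLp 2 hD hD' (1 : ℝ)) (hm.toLp _) := by
      rw [L2.inner_indicatorConstLp_one]
      refine integral_congr_ae (ae_restrict_of_ae ?_)
      filter_upwards [hm.coeFn_toLp] with x hx using hx.symm
    rw [e]
    exact (real_inner_le_norm _ _).trans (by gcongr)
  have i1 : IntegrableOn (fun x => u x - ballAvg R u x) D :=
    (hm.restrict D).integrable one_le_two
  calc ∫ x in D, u x ≤ ∫ x in D, ((u x - ballAvg R u x) + κ) := by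
        refine integral_mono hu.integrable.integrableOn (i1.add (integrable_const _)) fun x => ?_
        linarith [(ballAvg_le_of_integrable hu R x).2]
    _ = (∫ x in D, (u x - ballAvg R u x)) + volume.real D * κ := by
        rw [integral_add i1 (integrable_const _)]
        simp
    _ ≤ _ := by gcongr

/-- A Nash-type inequality recovering the L² norm from the gradient and the L¹ norm: write u² = u (u
- avg_1 u) + u avg_1 u. -/
theorem Adm.sq_norm_le {u : L2 N} (hu : Adm u) :
    ‖u‖ ^ 2 ≤ ‖u‖ * ‖weakGrad u‖ +
      (volume.real (Metric.ball (0 : E N) 1))⁻¹ * (∫ y, u y) ^ 2 := by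
  obtain ⟨hm, hle⟩ := hu.hasGrad.memLp_sub_ballAvg one_pos
  rw [one_mul] at hle
  set κ := (volume.real (Metric.ball (0 : E N) 1))⁻¹
  have e : ∫ x, u x * (u x - ballAvg 1 u x) = inner ℝ u (hm.toLp _) := by
    rw [L2.inner_def]
    refine integral_congr_ae ?_
    filter_upwards [hm.coeFn_toLp] with x hx
    simp [hx, mul_comm]
  have i1 : Integrable fun x => u x * (u x - ballAvg 1 u x) := (Lp.memLp u).integrable_mul hm
  rw [sq_norm_Lp_two]
  calc ∫ x, ‖u x‖ ^ 2 ≤ ∫ x, (u x * (u x - ballAvg 1 u x) + (κ * ∫ y, u y) * u x) := by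
        refine integral_mono_ae (integrable_sq_norm_Lp_two u)
          (i1.add (hu.integrable.const_mul _)) ?_
        filter_upwards [hu.nonneg] with x hx
        rw [Real.norm_of_nonneg hx]
        nlinarith [(ballAvg_le_of_integrable hu 1 x).2]
    _ = inner ℝ u (hm.toLp _) + κ * (∫ y, u y) ^ 2 := by
        rw [integral_add i1 (hu.integrable.const_mul _), e, integral_const_mul]
        ring
    _ ≤ _ := by
        gcongr
        exact (real_inner_le_norm _ _).trans (by gcongr)

namespace Tame

variable {f : E N → ℝ} {D : Set (E N)} {M c : ℝ}

/-- The radius n + 1 is taken so large that (M + c)|D|/|B| ≤ c/2; half of c ∫ u then pays for the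
mass on D. -/
theorem exists_le_energy (hf : Tame f D M c) (hN : 1 ≤ N) (hM : 0 < M) :
    ∃ B : ℝ, 0 ≤ B ∧ ∀ u : L2 N, Adm u →
      1 / 2 * ‖weakGrad u‖ ^ 2 + c / 2 * (∫ x, u x) - B * ‖weakGrad u‖ ≤ energy f u := by
  have hc := hf.pos
  obtain ⟨n, hn⟩ := ((tendsto_volume_real_ball hN).eventually_ge_atTop
    (2 * (M + c) * volume.real D / c + 1)).exists
  have hv : 0 ≤ volume.real D := measureReal_nonneg
  set κ := volume.real (Metric.ball (0 : E N) ((n : ℝ) + 1))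
  have hκ : 0 < κ := lt_of_lt_of_le (by positivity) hn
  refine ⟨(M + c) * (‖indicatorConstLp 2 hf.measurableSet hf.measure_ne_top (1 : ℝ)‖ * (n + 1)),
    by positivity, fun u hu => ?_⟩
  have h1 := hf.mul_sub_le_energy hu
  have h2 := hu.setIntegral_le hf.measurableSet hf.measure_ne_top (R := n + 1) (by positivity)
  have ht : 0 ≤ ∫ x, u x := integral_nonneg_of_ae hu.nonneg
  have h3 : (M + c) * (volume.real D * κ⁻¹) ≤ c / 2 := by
    rw [← mul_assoc, ← div_eq_mul_inv, div_le_iff₀ hκ]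
    have : 2 * (M + c) * volume.real D / c ≤ κ := by linarith
    rw [div_le_iff₀ hc] at this
    linarith
  have h4 := mul_le_mul_of_nonneg_left h2 (by positivity : 0 ≤ M + c)
  have h5 := mul_le_mul_of_nonneg_right h3 ht
  change (M + c) * _ ≤ (M + c) * (_ + volume.real D * (κ⁻¹ * ∫ y, u y)) at h4
  nlinarith

/-- Coercivity of the energy. -/
theorem exists_coercive (hf : Tame f D M c) (hN : 1 ≤ N) (hM : 0 < M) :
    (∃ B : ℝ, ∀ u : L2 N, Adm u → B ≤ energy f u) ∧
    ∀ T : ℝ, ∃ C : ℝ, ∀ u : L2 N, Adm u → energy f u ≤ T →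
      ‖u‖ ≤ C ∧ ‖weakGrad u‖ ≤ C ∧ ∫ x, u x ≤ C := by
  have hc := hf.pos
  obtain ⟨B, hB, h⟩ := hf.exists_le_energy hN hM
  constructor
  · refine ⟨-B ^ 2, fun u hu => ?_⟩
    have ht : 0 ≤ ∫ x, u x := integral_nonneg_of_ae hu.nonneg
    nlinarith [h u hu, sq_nonneg (‖weakGrad u‖ - B), mul_nonneg hc.le ht]
  · intro T
    set κ := (volume.real (Metric.ball (0 : E N) 1))⁻¹
    have hκ : 0 ≤ κ := inv_nonneg.2 measureReal_nonneg
    -- As t²/2 - B t = (t - B)²/2 - B²/2, a gradient norm above C1 would push the energy beyond |T|.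
    -- C2 then comes from (c/2) ∫ u ≤ T + B C1, and the L² bound from `Adm.sq_norm_le`.
    set C1 := B + 1 + 2 * |T| + B ^ 2
    set C2 := (|T| + B * C1) / (c / 2)
    have hC1 : 0 ≤ C1 := by positivity
    have hC2 : 0 ≤ C2 := by positivity
    refine ⟨C1 + C2 + κ * C2 ^ 2 + 1, fun u hu hT => ?_⟩
    have ht : 0 ≤ ∫ x, u x := integral_nonneg_of_ae hu.nonneg
    have h0 := h u hu
    have hT' := le_abs_self T
    have hT0 := abs_nonneg T
    have hg : ‖weakGrad u‖ ≤ C1 := by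
      by_contra! hlt
      have hlt' : 1 + 2 * |T| + B ^ 2 < ‖weakGrad u‖ - B := by simp only [C1] at hlt; linarith
      nlinarith [mul_nonneg hc.le ht, sq_nonneg B]
    have hi : ∫ x, u x ≤ C2 := by
      rw [le_div_iff₀ (by positivity)]
      nlinarith [norm_nonneg (weakGrad u), mul_le_mul_of_nonneg_left hg hB]
    have hs := hu.sq_norm_le
    have hi2 : κ * (∫ x, u x) ^ 2 ≤ κ * C2 ^ 2 := by gcongr
    have hq : 0 ≤ κ * C2 ^ 2 := by positivity
    refine ⟨?_, by linarith, by linarith⟩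
    by_contra! hlt
    have h1 : κ * C2 ^ 2 + 1 < ‖u‖ - ‖weakGrad u‖ := by linarith
    nlinarith [norm_nonneg u, norm_nonneg (weakGrad u)]

end Tame

/-! ### Submodularity, convexity and lower semicontinuity -/

namespace Adm

variable {u w : L2 N}

theorem zero : Adm (0 : L2 N) := by
  have h := HasGrad.zero (N := N)
  refine ⟨by rwa [h.weakGrad_eq], ?_, ?_⟩
  · filter_upwards [Lp.coeFn_zero ℝ 2 (volume : Measure (E N))] with x hx
    rw [hx]; rfl
  · exact (integrable_zero _ _ _).congr (Lp.coeFn_zero ℝ 2 (volume : Measure (E N))).symm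

theorem inf (hu : Adm u) (hw : Adm w) : Adm (u ⊓ w) := by
  obtain ⟨A, B, hA, -, -⟩ := hu.hasGrad.exists_inf_sup hw.hasGrad
  have e := Lp.coeFn_inf u w
  refine ⟨by rwa [hA.weakGrad_eq], ?_, (hu.integrable.inf hw.integrable).congr e.symm⟩
  filter_upwards [e, hu.nonneg, hw.nonneg] with x h1 h2 h3
  rw [h1]
  exact le_inf h2 h3

theorem sup (hu : Adm u) (hw : Adm w) : Adm (u ⊔ w) := by
  obtain ⟨A, B, -, hB, -⟩ := hu.hasGrad.exists_inf_sup hw.hasGrad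
  have e := Lp.coeFn_sup u w
  refine ⟨by rwa [hB.weakGrad_eq], ?_, (hu.integrable.sup hw.integrable).congr e.symm⟩
  filter_upwards [e, hu.nonneg] with x h1 h2
  rw [h1]
  exact le_sup_of_le_left h2

theorem half_add (hu : Adm u) (hw : Adm w) : Adm ((2⁻¹ : ℝ) • (u + w)) := by
  have h := (hu.hasGrad.add hw.hasGrad).smul 2⁻¹
  have e := Lp.coeFn_smul (2⁻¹ : ℝ) (u + w)
  have e' := Lp.coeFn_add u w
  refine ⟨by rwa [h.weakGrad_eq], ?_, ?_⟩
  · filter_upwards [e, e', hu.nonneg, hw.nonneg] with x h1 h2 h3 h4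
    rw [h1, Pi.smul_apply, h2, Pi.add_apply, smul_eq_mul]
    positivity
  · refine ((hu.integrable.add hw.integrable).smul (2⁻¹ : ℝ)).congr ?_
    filter_upwards [e, e'] with x h1 h2
    rw [h1, Pi.smul_apply, Pi.smul_apply, h2]

end Adm

namespace Tame

variable {f : E N → ℝ} {D : Set (E N)} {M c : ℝ} {u w : L2 N}

/-- Submodularity of the energy. -/
theorem energy_inf_add_sup_le (hf : Tame f D M c) (hu : Adm u) (hw : Adm w) :
    energy f (u ⊓ w) + energy f (u ⊔ w) ≤ energy f u + energy f w := by
  obtain ⟨A, B, hA, hB, hle⟩ := hu.hasGrad.exists_inf_sup hw.hasGrad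
  have e : (∫ x, f x * (u ⊓ w : L2 N) x) + ∫ x, f x * (u ⊔ w : L2 N) x =
      (∫ x, f x * u x) + ∫ x, f x * w x := by
    rw [← integral_add (hf.integrable_mul (hu.inf hw).integrable)
      (hf.integrable_mul (hu.sup hw).integrable), ← integral_add (hf.integrable_mul hu.integrable)
      (hf.integrable_mul hw.integrable)]
    refine integral_congr_ae ?_
    filter_upwards [Lp.coeFn_inf u w, Lp.coeFn_sup u w] with x h1 h2
    rw [h1, h2, Pi.inf_apply, Pi.sup_apply, ← mul_add, ← mul_add, inf_add_sup]
  rw [energy, energy, energy, energy, hA.weakGrad_eq, hB.weakGrad_eq]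
  linarith

/-- The parallelogram law gives the exact convexity defect, which is what uniqueness needs. -/
theorem energy_half_add (hf : Tame f D M c) (hu : Adm u) (hw : Adm w) :
    energy f ((2⁻¹ : ℝ) • (u + w)) =
      2⁻¹ * energy f u + 2⁻¹ * energy f w - 8⁻¹ * ‖weakGrad u - weakGrad w‖ ^ 2 := by
  have h := (hu.hasGrad.add hw.hasGrad).smul 2⁻¹
  have e : ∫ x, f x * ((2⁻¹ : ℝ) • (u + w) : L2 N) x =
      2⁻¹ * (∫ x, f x * u x) + 2⁻¹ * ∫ x, f x * w x := by
    rw [← mul_add, ← integral_add (hf.integrable_mul hu.integrable)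
      (hf.integrable_mul hw.integrable), ← integral_const_mul]
    refine integral_congr_ae ?_
    filter_upwards [Lp.coeFn_smul (2⁻¹ : ℝ) (u + w), Lp.coeFn_add u w] with x h1 h2
    rw [h1, Pi.smul_apply, h2, Pi.add_apply, smul_eq_mul]
    ring
  have p := parallelogram_law_with_norm ℝ (weakGrad u) (weakGrad w)
  rw [energy, energy, energy, e, h.weakGrad_eq, norm_smul, mul_pow]
  norm_num
  nlinarith

/-- Lower semicontinuity of the energy. -/
theorem energy_lsc (hf : Tame f D M c) {u : ℕ → L2 N} {z : L2 N} {T : ℝ}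
    (hu : ∀ n, Adm (u n)) (hT : ∀ n, ∫ x, u n x ≤ T) (hz : HasGrad z (weakGrad z))
    (hw : ∀ y, Tendsto (fun n => inner ℝ (u n) y) atTop (𝓝 (inner ℝ z y)))
    (hw' : ∀ y, Tendsto (fun n => inner ℝ (weakGrad (u n)) y) atTop (𝓝 (inner ℝ (weakGrad z) y)))
    (hae : ∀ᵐ x, Tendsto (fun n => u n x) atTop (𝓝 (z x))) :
    Adm z ∧ ∀ ε > 0, ∀ᶠ n in atTop, energy f z - ε ≤ energy f (u n) := by
  have hum : ∀ w : L2 N, AEMeasurable w volume := fun w =>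
    (Lp.stronglyMeasurable w).measurable.aemeasurable
  have hnn : ∀ᵐ x, 0 ≤ z x := by
    filter_upwards [hae, ae_all_iff.2 fun n => (hu n).nonneg] with x h1 h2
    exact ge_of_tendsto' h1 h2
  -- Fatou's lemma with a weight
  have fatou : ∀ p : E N → ℝ, AEMeasurable p volume →
      ∫⁻ x, ENNReal.ofReal (p x * z x) ≤
        liminf (fun n => ∫⁻ x, ENNReal.ofReal (p x * u n x)) atTop := by
    intro p hp
    refine le_trans (lintegral_mono_ae ?_) (lintegral_liminf_le' fun n =>
      (hp.mul (hum (u n))).ennreal_ofReal)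
    filter_upwards [hae] with x hx
    exact (ENNReal.tendsto_ofReal (hx.const_mul (p x))).liminf_eq.ge
  have hzi : Integrable z volume := by
    refine ⟨(Lp.stronglyMeasurable z).aestronglyMeasurable, ?_⟩
    rw [hasFiniteIntegral_iff_ofReal hnn]
    have h1 := fatou (fun _ => 1) aemeasurable_const
    simp only [one_mul] at h1
    refine lt_of_le_of_lt (h1.trans (liminf_le_of_frequently_le' (x := ENNReal.ofReal T)
      (Frequently.of_forall fun n => ?_))) ENNReal.ofReal_lt_top
    rw [← ofReal_integral_eq_lintegral_ofReal (hu n).integrable (hu n).nonneg]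
    exact ENNReal.ofReal_le_ofReal (hT n)
  have hzA : Adm z := ⟨hz, hnn, hzi⟩
  refine ⟨hzA, fun ε hε => ?_⟩
  -- Write f = M 1_D - p with p ≥ 0: Fatou handles ∫ p u, and M ∫_D u is weakly continuous.
  let p : E N → ℝ := fun x => D.indicator (fun _ => M) x - f x
  have hp : AEMeasurable p volume :=
    (aemeasurable_const.indicator hf.measurableSet).sub hf.aesm.aemeasurable
  have hp0 : ∀ᵐ x, 0 ≤ p x := by
    filter_upwards [hf.bound, hf.le_neg] with x h1 h2
    by_cases hx : x ∈ D
    · simp only [p, indicator_of_mem hx]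
      linarith [le_abs_self (f x)]
    · simp only [p, indicator_of_notMem hx]
      linarith [h2 hx, hf.pos]
  have hpe : ∀ w : L2 N, ∀ x, p x * w x = M * D.indicator w x - f x * w x := by
    intro w x
    by_cases hx : x ∈ D
    · simp only [p, indicator_of_mem hx]; ring
    · simp only [p, indicator_of_notMem hx]; ring
  have hpi : ∀ w : L2 N, Adm w → Integrable fun x => p x * w x := by
    intro w hw
    refine (((hf.integrable_indicator w).const_mul M).sub
      (hf.integrable_mul hw.integrable)).congr (ae_of_all _ fun x => (hpe w x).symm)
  let q : L2 N → ℝ := fun w =>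
    inner ℝ w (indicatorConstLp 2 hf.measurableSet hf.measure_ne_top (1 : ℝ))
  have hpint : ∀ w : L2 N, Adm w → ∫ x, f x * w x = M * q w - ∫ x, p x * w x := by
    intro w hw
    have h1 : q w = ∫ x, D.indicator w x := by
      simp only [q]
      rw [real_inner_comm, L2.inner_indicatorConstLp_one, integral_indicator hf.measurableSet]
    simp only [hpe]
    rw [integral_sub ((hf.integrable_indicator w).const_mul M) (hf.integrable_mul hw.integrable),
      integral_const_mul, h1]
    ring
  have hpnn : ∀ w : L2 N, Adm w → ∀ᵐ x, 0 ≤ p x * w x := by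
    intro w hw
    filter_upwards [hp0, hw.nonneg] with x h1 h2 using mul_nonneg h1 h2
  have ev1 : ∀ᶠ n in atTop, (∫ x, p x * z x) - ε / 4 ≤ ∫ x, p x * u n x := by
    have hF := fatou p hp
    rw [← ofReal_integral_eq_lintegral_ofReal (hpi z hzA) (hpnn z hzA)] at hF
    rcases lt_or_ge 0 (∫ x, p x * z x) with h0 | h0
    · have hlt : ENNReal.ofReal ((∫ x, p x * z x) - ε / 4) <
          liminf (fun n => ∫⁻ x, ENNReal.ofReal (p x * u n x)) atTop :=
        lt_of_lt_of_le ((ENNReal.ofReal_lt_ofReal_iff h0).2 (by linarith)) hF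
      filter_upwards [eventually_lt_of_lt_liminf hlt] with n hn
      rw [← ofReal_integral_eq_lintegral_ofReal (hpi _ (hu n)) (hpnn _ (hu n))] at hn
      exact (ENNReal.ofReal_le_ofReal_iff (integral_nonneg_of_ae (hpnn _ (hu n)))).1 hn.le
    · refine Eventually.of_forall fun n => ?_
      have : 0 ≤ ∫ x, p x * u n x := integral_nonneg_of_ae (hpnn _ (hu n))
      linarith
  have ev2 : ∀ᶠ n in atTop, M * q (u n) < M * q z + ε / 4 :=
    ((hw _).const_mul M).eventually_lt_const (by linarith)
  have ev3 : ∀ᶠ n in atTop, ‖weakGrad z‖ ^ 2 - ε / 4 < inner ℝ (weakGrad (u n)) (weakGrad z) := by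
    refine (hw' (weakGrad z)).eventually_const_lt ?_
    rw [real_inner_self_eq_norm_sq]
    linarith
  filter_upwards [ev1, ev2, ev3] with n h1 h2 h3
  rw [energy, energy, hpint _ hzA, hpint _ (hu n)]
  -- Uses ‖G_n‖²/2 ≥ ⟨G_n, G⟩ - ‖G‖²/2; each of the three terms loses at most ε/4.
  have h4 := real_inner_le_norm (weakGrad (u n)) (weakGrad z)
  nlinarith [sq_nonneg (‖weakGrad (u n)‖ - ‖weakGrad z‖)]

end Tame

/-! ### A compactly supported barrier -/

theorem exists_abs_deriv_smoothTransition_le :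
    ∃ B : ℝ, 0 ≤ B ∧ ∀ t, |deriv Real.smoothTransition t| ≤ B := by
  have hc : Continuous (deriv Real.smoothTransition) :=
    (Real.smoothTransition.contDiff (n := 1)).continuous_deriv le_rfl
  obtain ⟨B, hB⟩ := (isCompact_Icc (a := (0 : ℝ)) (b := 1)).exists_bound_of_continuousOn
    hc.continuousOn
  have hB0 : 0 ≤ B := (norm_nonneg _).trans (hB 0 (by simp))
  refine ⟨B, hB0, fun t => ?_⟩
  by_cases ht : t ∈ Icc (0 : ℝ) 1
  · exact hB t ht
  · rw [mem_Icc, not_and_or, not_le, not_le] at ht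
    have h0 : deriv Real.smoothTransition t = 0 := by
      rcases ht with ht | ht
      · refine IsLocalMin.deriv_eq_zero (Eventually.of_forall fun y => ?_)
        rw [Real.smoothTransition.zero_of_nonpos ht.le]
        exact Real.smoothTransition.nonneg y
      · refine IsLocalMax.deriv_eq_zero (Eventually.of_forall fun y => ?_)
        rw [Real.smoothTransition.one_of_one_le ht.le]
        exact Real.smoothTransition.le_one y
    simpa [h0] using hB0

/-- A slowly decreasing smooth profile. -/
theorem exists_slow_cutoff {A c : ℝ} (hA : 0 < A) (hc : 0 < c) (r : ℝ) :
    ∃ (k : ℝ → ℝ) (L : ℝ), ContDiff ℝ ∞ k ∧ 0 < L ∧ (∀ s, 0 ≤ k s) ∧ (∀ s, L ≤ s → k s = 0) ∧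
      (∀ s, |s| ≤ r → k s = A ∧ deriv k s = 0) ∧ ∀ s, |s * deriv k s| ≤ c := by
  obtain ⟨B, hB, hBd⟩ := exists_abs_deriv_smoothTransition_le
  -- The profile is a cutoff in ε log(1 + s²). Since s · d/ds log(1 + s²) ≤ 2, |s k'(s)| ≤ 2AεB ≤ c;
  -- the `+ 1` covers B = 0.
  set ε := c / (2 * A * B + 1)
  have hε : 0 < ε := by positivity
  -- Makes the cutoff argument at least 1 for |s| ≤ r; it is nonpositive once s ≥ exp(a/ε).
  set a := 1 + ε * Real.log (1 + r ^ 2)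
  have ha : 1 ≤ a := by
    have := Real.log_nonneg (show 1 ≤ 1 + r ^ 2 by nlinarith)
    simp only [a]
    nlinarith
  have hpos : ∀ s : ℝ, 0 < 1 + s ^ 2 := fun s => by positivity
  let g : ℝ → ℝ := fun s => a - ε * Real.log (1 + s ^ 2)
  let k : ℝ → ℝ := fun s => A * Real.smoothTransition (g s)
  have hg : ∀ s, HasDerivAt g (-(ε * (2 * s / (1 + s ^ 2)))) s := by
    intro s
    have h1 : HasDerivAt (fun s : ℝ => 1 + s ^ 2) (2 * s) s := by
      simpa using (hasDerivAt_pow 2 s).const_add 1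
    exact ((h1.log (hpos s).ne').const_mul ε).const_sub a
  have hk : ∀ s, HasDerivAt k
      (A * (deriv Real.smoothTransition (g s) * (-(ε * (2 * s / (1 + s ^ 2)))))) s := fun s =>
    (((Real.smoothTransition.contDiff (n := 1)).differentiable one_ne_zero
      (g s)).hasDerivAt.comp s (hg s)).const_mul A
  have hgd : ContDiff ℝ ∞ g := contDiff_const.sub (contDiff_const.mul
    ((contDiff_const.add (contDiff_id.pow 2)).log fun s => (hpos s).ne'))
  have hkA : ∀ s, k s ≤ A := fun s =>
    mul_le_of_le_one_right hA.le (Real.smoothTransition.le_one _)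
  refine ⟨k, Real.exp (a / ε), contDiff_const.mul (Real.smoothTransition.contDiff.comp hgd),
    Real.exp_pos _, fun s => mul_nonneg hA.le (Real.smoothTransition.nonneg _), fun s hs => ?_,
    fun s hs => ?_, fun s => ?_⟩
  · have h1 : a / ε ≤ Real.log (1 + s ^ 2) := by
      rw [Real.le_log_iff_exp_le (hpos s)]
      nlinarith [sq_nonneg (s - 1)]
    rw [div_le_iff₀ hε] at h1
    simp only [k]
    rw [Real.smoothTransition.zero_of_nonpos (by simp only [g]; linarith), mul_zero]
  · have h1 : Real.log (1 + s ^ 2) ≤ Real.log (1 + r ^ 2) := by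
      refine Real.log_le_log (hpos s) ?_
      have := sq_le_sq' (by linarith [abs_le.1 hs]) (abs_le.1 hs).2
      linarith
    have h2 : k s = A := by
      simp only [k]
      rw [Real.smoothTransition.one_of_one_le, mul_one]
      simp only [g, a]
      nlinarith
    refine ⟨h2, IsLocalMax.deriv_eq_zero (Eventually.of_forall fun y => ?_)⟩
    rw [h2]
    exact hkA y
  · rw [(hk s).deriv]
    have e : s * (A * (deriv Real.smoothTransition (g s) * (-(ε * (2 * s / (1 + s ^ 2)))))) =
        -(2 * A * ε * deriv Real.smoothTransition (g s) * (s ^ 2 / (1 + s ^ 2))) := by ring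
    have h1 : s ^ 2 / (1 + s ^ 2) ≤ 1 := (div_le_one (hpos s)).2 (by linarith)
    have h2 : 0 ≤ s ^ 2 / (1 + s ^ 2) := by positivity
    rw [e, abs_neg, abs_mul, abs_mul, abs_of_nonneg h2, abs_of_pos (by positivity : 0 < 2 * A * ε)]
    calc 2 * A * ε * |deriv Real.smoothTransition (g s)| * (s ^ 2 / (1 + s ^ 2))
        ≤ 2 * A * ε * B * 1 := by gcongr; exact hBd _
      _ = c * (2 * A * B / (2 * A * B + 1)) := by simp only [ε]; field_simp
      _ ≤ c * 1 := by
          gcongr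
          exact (div_le_one (by positivity)).2 (by linarith)
      _ = c := mul_one c

theorem hasFDerivAt_comp_norm_sq {k : ℝ → ℝ} (hk : Differentiable ℝ k) (x : E N) :
    HasFDerivAt (fun x : E N => k (‖x‖ ^ 2)) (deriv k (‖x‖ ^ 2) • (2 • innerSL ℝ x)) x :=
  (hk _).hasDerivAt.comp_hasFDerivAt x (hasStrictFDerivAt_norm_sq x).hasFDerivAt

/-- The divergence of a radial field, tested against `φ`. -/
theorem IsTest.integral_radial {φ : E N → ℝ} (h : IsTest φ) {k : ℝ → ℝ} (hk : ContDiff ℝ ∞ k) :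
    ∫ x, k (‖x‖ ^ 2) * fderiv ℝ φ x x =
      -∫ x, (N * k (‖x‖ ^ 2) + 2 * (‖x‖ ^ 2 * deriv k (‖x‖ ^ 2))) * φ x := by
  have hkd : Differentiable ℝ k := hk.differentiable (by simp)
  have hkc : Continuous (deriv k) := hk.continuous_deriv (by simp)
  let e : Fin N → E N := fun i => EuclideanSpace.single i 1
  have hφc : ∀ v, Continuous fun x => fderiv ℝ φ x v := fun v =>
    (h.1.continuous_fderiv (by simp)).clm_apply continuous_const
  have hx : ∀ x : E N, x = ∑ i, x i • e i := by
    intro x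
    have := (EuclideanSpace.basisFun (Fin N) ℝ).sum_repr x
    simpa [e] using this.symm
  have hcomp : ∀ (i : Fin N) (x : E N), HasFDerivAt (fun x : E N => k (‖x‖ ^ 2) * x i)
      (k (‖x‖ ^ 2) • EuclideanSpace.proj i + x i • (deriv k (‖x‖ ^ 2) • (2 • innerSL ℝ x))) x :=
    fun i x => (hasFDerivAt_comp_norm_sq hkd x).mul
      (EuclideanSpace.proj (𝕜 := ℝ) i).hasFDerivAt
  have hcompd : ∀ (i : Fin N) (x : E N), fderiv ℝ (fun x : E N => k (‖x‖ ^ 2) * x i) x (e i) =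
      k (‖x‖ ^ 2) + 2 * (x i ^ 2 * deriv k (‖x‖ ^ 2)) := by
    intro i x
    rw [(hcomp i x).fderiv]
    simp [e, EuclideanSpace.inner_single_right]
    ring
  have hcc : ∀ i : Fin N, Continuous fun x : E N => k (‖x‖ ^ 2) * x i := fun i => by
    have := hk.continuous
    fun_prop
  have hdc : ∀ i : Fin N, Continuous fun x : E N =>
      k (‖x‖ ^ 2) + 2 * (x i ^ 2 * deriv k (‖x‖ ^ 2)) := fun i => by
    have := hk.continuous
    fun_prop
  have i1 : ∀ i, Integrable fun x => k (‖x‖ ^ 2) * x i * fderiv ℝ φ x (e i) := fun i =>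
    ((hcc i).mul (hφc _)).integrable_of_hasCompactSupport (HasCompactSupport.mul_left
      (h.2.fderiv_apply (𝕜 := ℝ) (e i)))
  have i2 : ∀ i : Fin N, Integrable fun x : E N =>
      (k (‖x‖ ^ 2) + 2 * (x i ^ 2 * deriv k (‖x‖ ^ 2))) * φ x := fun i =>
    ((hdc i).mul h.1.continuous).integrable_of_hasCompactSupport h.2.mul_left
  have parts : ∀ i, ∫ x, k (‖x‖ ^ 2) * x i * fderiv ℝ φ x (e i) =
      -∫ x, (k (‖x‖ ^ 2) + 2 * (x i ^ 2 * deriv k (‖x‖ ^ 2))) * φ x := by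
    intro i
    have := integral_mul_fderiv_eq_neg_fderiv_mul_of_integrable
      (μ := (volume : Measure (E N))) (f := fun x : E N => k (‖x‖ ^ 2) * x i) (g := φ) (v := e i)
      (by simpa only [hcompd] using i2 i) (i1 i)
      (((hcc i).mul h.1.continuous).integrable_of_hasCompactSupport h.2.mul_left)
      (fun x _ => (hcomp i x).differentiableAt) (fun x _ => h.differentiable x)
    simpa only [hcompd] using this
  calc ∫ x, k (‖x‖ ^ 2) * fderiv ℝ φ x x
      = ∫ x, ∑ i, k (‖x‖ ^ 2) * x i * fderiv ℝ φ x (e i) := by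
        refine integral_congr_ae (ae_of_all _ fun x => ?_)
        have : fderiv ℝ φ x x = ∑ i, x i * fderiv ℝ φ x (e i) := by
          refine (congrArg (fderiv ℝ φ x) (hx x)).trans ?_
          simp only [map_sum, map_smul, smul_eq_mul]
        simp only [this, Finset.mul_sum, mul_assoc]
    _ = ∑ i, -∫ x, (k (‖x‖ ^ 2) + 2 * (x i ^ 2 * deriv k (‖x‖ ^ 2))) * φ x := by
        rw [integral_finsetSum _ fun i _ => i1 i]
        exact Finset.sum_congr rfl fun i _ => parts i
    _ = -∫ x, ∑ i, (k (‖x‖ ^ 2) + 2 * (x i ^ 2 * deriv k (‖x‖ ^ 2))) * φ x := by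
        rw [Finset.sum_neg_distrib, integral_finsetSum _ fun i _ => i2 i]
    _ = _ := by
        congr 1
        refine integral_congr_ae (ae_of_all _ fun x => ?_)
        simp only
        rw [← Finset.sum_mul, Finset.sum_add_distrib, ← Finset.mul_sum, ← Finset.sum_mul,
          ← EuclideanSpace.real_norm_sq_eq]
        simp

/-- A compactly supported smooth supersolution. -/
theorem exists_barrier (hN : 1 ≤ N) {D : Set (E N)} (hD : IsCompact D) {M c : ℝ} (hM : 0 < M)
    (hc : 0 < c) : ∃ (w : E N → ℝ) (F : E N → ℝ), IsTest w ∧ (∀ x, 0 ≤ w x) ∧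
      Continuous F ∧ HasCompactSupport F ∧ (∀ x ∈ D, M ≤ F x) ∧ (∀ x, -c ≤ F x) ∧
      ∀ φ, IsTest φ → ∫ x, inner ℝ (∇ φ x) (∇ w x) = ∫ x, φ x * F x := by
  have hN' : (0 : ℝ) < N := by exact_mod_cast hN
  obtain ⟨r, hr⟩ := hD.isBounded.subset_closedBall 0
  -- The source will be F = 2N k + 4 s k' at s = ‖x‖². On D, k' = 0 and F = 2N A = M; everywhere 4 s
  -- k' ≥ -c. The radius is squared because the profile variable is ‖x‖².
  obtain ⟨k, L, hk, hL, hk0, hkL, hkr, hkc⟩ := exists_slow_cutoff (A := M / (2 * N)) (c := c / 4)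
    (by positivity) (by positivity) (r ^ 2)
  have hkL' : ∀ s, L ≤ s → deriv k s = 0 := fun s hs => by
    refine IsLocalMin.deriv_eq_zero (Eventually.of_forall fun y => ?_)
    rw [hkL s hs]
    exact hk0 y
  have hkcont := hk.continuous
  have hkcont' : Continuous (deriv k) := hk.continuous_deriv (by simp)
  -- With g' = -k, the function w = g(‖x‖²) has ∇w = -2 k x, so -Δw = 2 div(k x) = F.
  let g : ℝ → ℝ := fun s => ∫ t in s..L, k t
  have hg : ∀ s, HasDerivAt g (-k s) s := fun s =>
    intervalIntegral.integral_hasDerivAt_left (hkcont.intervalIntegrable _ _)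
      (hkcont.stronglyMeasurableAtFilter _ _) hkcont.continuousAt
  have hgd : deriv g = fun s => -k s := funext fun s => (hg s).deriv
  have hgdiff : Differentiable ℝ g := fun s => (hg s).differentiableAt
  have hgsm : ContDiff ℝ ∞ g := by
    rw [contDiff_infty_iff_deriv, hgd]
    exact ⟨hgdiff, hk.neg⟩
  have hgL : ∀ s, L ≤ s → g s = 0 := by
    intro s hs
    simp only [g]
    rw [intervalIntegral.integral_symm, neg_eq_zero]
    refine intervalIntegral.integral_zero_ae (ae_of_all _ fun t ht => ?_)
    rw [uIoc_of_le hs] at ht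
    exact hkL t ht.1.le
  have hg0 : ∀ s, 0 ≤ g s := by
    intro s
    rcases le_total L s with hs | hs
    · exact (hgL s hs).ge
    · exact intervalIntegral.integral_nonneg hs fun t _ => hk0 t
  have hout : ∀ x : E N, x ∉ Metric.closedBall 0 √L → L ≤ ‖x‖ ^ 2 := by
    intro x hx
    rw [mem_closedBall_zero_iff, not_le] at hx
    exact ((Real.sqrt_lt' (lt_of_le_of_lt (Real.sqrt_nonneg _) hx)).1 hx).le
  let w : E N → ℝ := fun x => g (‖x‖ ^ 2)
  have hw : IsTest w := by
    refine ⟨hgsm.comp (contDiff_norm_sq ℝ), ?_⟩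
    exact HasCompactSupport.intro (isCompact_closedBall 0 √L) fun x hx => hgL _ (hout x hx)
  have hwg : ∀ x, ∇ w x = (-2 * k (‖x‖ ^ 2)) • x := by
    intro x
    refine ext_inner_right ℝ fun v => ?_
    rw [inner_gradient_left, (hasFDerivAt_comp_norm_sq hgdiff x).fderiv, hgd, inner_smul_left]
    simp
    ring
  refine ⟨w, fun x => 2 * (N * k (‖x‖ ^ 2) + 2 * (‖x‖ ^ 2 * deriv k (‖x‖ ^ 2))), hw,
    fun x => hg0 _, by fun_prop, ?_, fun x hx => ?_, fun x => ?_, fun φ hφ => ?_⟩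
  · refine HasCompactSupport.intro (isCompact_closedBall 0 √L) fun x hx => ?_
    simp [hkL _ (hout x hx), hkL' _ (hout x hx)]
  · have h1 := mem_closedBall_zero_iff.1 (hr hx)
    obtain ⟨h2, h3⟩ := hkr (‖x‖ ^ 2) (by
      rw [abs_of_nonneg (by positivity)]
      gcongr)
    simp only [h2, h3]
    field_simp
    simp
  · have h1 := (abs_le.1 (hkc (‖x‖ ^ 2))).1
    have h2 := mul_nonneg hN'.le (hk0 (‖x‖ ^ 2))
    linarith
  · have h1 : ∀ x, inner ℝ (∇ φ x) (∇ w x) = -2 * (k (‖x‖ ^ 2) * fderiv ℝ φ x x) := by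
      intro x
      rw [hwg, inner_smul_right, inner_gradient_left]
      ring
    simp only [h1]
    rw [integral_const_mul, hφ.integral_radial hk, neg_mul_neg, ← integral_const_mul]
    refine integral_congr_ae (ae_of_all _ fun x => ?_)
    ring

theorem HasGrad.eq_of_weakGrad_eq (hN : 1 ≤ N) {u w : L2 N} (hu : HasGrad u (weakGrad u))
    (hw : HasGrad w (weakGrad w)) (h : weakGrad u = weakGrad w) : u = w := by
  have h0 := hu.sub hw
  rw [h, sub_self] at h0
  exact sub_eq_zero.1 (h0.eq_zero hN)

/-- Scalar minimizers lie below a test function. -/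
theorem Tame.exists_le_isTest {f : E N → ℝ} {D : Set (E N)} {M c : ℝ} (hf : Tame f D M c)
    (hN : 1 ≤ N) (hD : IsCompact D) (hM : 0 < M) {v : L2 N} (hv : Adm v)
    (hmin : ∀ w, Adm w → energy f v ≤ energy f w) :
    ∃ w : E N → ℝ, IsTest w ∧ ∀ᵐ x, v x ≤ w x := by
  obtain ⟨w, F, hw, hw0, hFc, hFs, hFD, hFge, hid⟩ := exists_barrier hN hD hM hf.pos
  refine ⟨w, hw, ?_⟩
  set W := hw.memLp.toLp w
  have hWe : W =ᵐ[volume] w := hw.memLp.coeFn_toLp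
  have hWg := hw.hasGrad
  have hWG : weakGrad W = hw.memLp_gradient.toLp (∇ w) := hWg.weakGrad_eq
  have hWA : Adm W := by
    refine ⟨by rw [hWG]; exact hWg, ?_, ?_⟩
    · filter_upwards [hWe] with x hx
      rw [hx]; exact hw0 x
    · exact (hw.1.continuous.integrable_of_hasCompactSupport hw.2).congr hWe.symm
  have hF2 : MemLp F 2 volume := hFc.memLp_of_hasCompactSupport hFs
  -- The equation -Δw = F, now tested with any element of W_0^{1,2}.
  have hpair : ∀ z : L2 N, HasGrad z (weakGrad z) →
      inner ℝ (weakGrad z) (weakGrad W) = ∫ x, F x * z x := by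
    intro z hz
    have h1 := hz.inner_add_inner_eq_zero hF2 hw.memLp_gradient.neg (by
      intro φ hφ
      have i2 : Integrable fun x => inner ℝ (∇ φ x) (∇ w x) := by
        refine (L2.integrable_inner (𝕜 := ℝ) (hφ.memLp_gradient.toLp _)
          (hw.memLp_gradient.toLp _)).congr ?_
        filter_upwards [hφ.memLp_gradient.coeFn_toLp, hw.memLp_gradient.coeFn_toLp] with x h1 h2
        rw [h1, h2]
      have i1 : Integrable fun x => φ x * F x := hφ.memLp.integrable_mul hF2
      simp only [Pi.neg_apply, inner_neg_right, ← sub_eq_add_neg]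
      rw [integral_sub i1 i2, hid φ hφ, sub_self])
    simp only [Pi.neg_apply, inner_neg_right, integral_neg] at h1
    rw [L2.inner_def, hWG]
    have h2 : ∫ x, inner ℝ (weakGrad z x) (hw.memLp_gradient.toLp (∇ w) x) =
        ∫ x, inner ℝ (weakGrad z x) (∇ w x) := by
      refine integral_congr_ae ?_
      filter_upwards [hw.memLp_gradient.coeFn_toLp] with x hx
      rw [hx]
    rw [h2]
    simp only [mul_comm (F _)]
    linarith
  have hz := hv.sup hWA
  have hsub := hf.energy_inf_add_sup_le hv hWA
  have hle : energy f (v ⊔ W) ≤ energy f W := by linarith [hmin _ (hv.inf hWA)]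
  have hFi : ∀ z : L2 N, Integrable fun x => F x * z x := fun z =>
    hF2.integrable_mul (Lp.memLp z)
  have hcomp : (∫ x, f x * (v ⊔ W : L2 N) x) - (∫ x, f x * W x) ≤
      (∫ x, F x * (v ⊔ W : L2 N) x) - ∫ x, F x * W x := by
    rw [← integral_sub (hf.integrable_mul hz.integrable) (hf.integrable_mul hWA.integrable),
      ← integral_sub (hFi _) (hFi _)]
    refine integral_mono_ae ((hf.integrable_mul hz.integrable).sub
      (hf.integrable_mul hWA.integrable)) ((hFi _).sub (hFi _)) ?_
    filter_upwards [Lp.coeFn_sup v W, hf.bound, hf.le_neg] with x h1 h2 h3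
    have h4 : W x ≤ (v ⊔ W : L2 N) x := by rw [h1]; exact le_sup_right
    have h5 : f x ≤ F x := by
      by_cases hx : x ∈ D
      · exact (le_abs_self _).trans (h2.trans (hFD x hx))
      · exact (h3 hx).trans (hFge x)
    nlinarith
  -- With z = v ⊔ W ≥ W and f ≤ F, the bound E(z) ≤ E(W) and the equation for W combine to ‖∇z -
  -- ∇W‖² ≤ 0.
  have hg : weakGrad (v ⊔ W) = weakGrad W := by
    rw [← sub_eq_zero, ← norm_eq_zero, ← sq_eq_zero_iff]
    refine le_antisymm ?_ (sq_nonneg _)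
    rw [norm_sub_sq_real, hpair _ hz.hasGrad]
    have h1 := hpair _ hWA.hasGrad
    rw [real_inner_self_eq_norm_sq] at h1
    rw [energy, energy] at hle
    linarith
  have heq := HasGrad.eq_of_weakGrad_eq hN hz.hasGrad hWA.hasGrad hg
  have hvW : v ≤ W := by rw [← heq]; exact le_sup_left
  filter_upwards [(Lp.coeFn_le v W).2 hvW, hWe] with x h1 h2
  rwa [← h2]

/-! ### Essential supports -/

theorem essSupport_subset_of_le {u v : E N → ℝ} (hu : ∀ᵐ x, 0 ≤ u x) (h : ∀ᵐ x, u x ≤ v x) :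
    essSupport u ⊆ essSupport v := by
  refine Measure.support_mono (Measure.restrict_mono_ae ?_)
  filter_upwards [hu, h] with x h1 h2 (hx : u x ≠ 0)
  exact ((lt_of_le_of_ne h1 hx.symm).trans_le h2).ne'

theorem isClosed_essSupport (u : E N → ℝ) : IsClosed (essSupport u) :=
  Measure.isClosed_support

theorem IsTest.isCompact_essSupport {w : E N → ℝ} (hw : IsTest w) : IsCompact (essSupport w) := by
  refine hw.2.isCompact.of_isClosed_subset (isClosed_essSupport w)
    (Measure.support_subset_of_isClosed (isClosed_tsupport w) ?_)
  refine ae_restrict_of_ae_restrict_of_subset (subset_tsupport w) ?_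
  exact ae_restrict_mem (isClosed_tsupport w).measurableSet

/-! ### The vector problem -/

theorem S_subset_K : S N m ⊆ K N m := fun _ hu => hu.1

theorem mem_K_iff {u : Fin m → L2 N} :
    u ∈ K N m ↔ ∀ i, HasGrad (u i) (weakGrad (u i)) ∧ ∀ᵐ x, 0 ≤ u i x :=
  forall_congr' fun _ => and_congr_left fun _ => mem_W012_iff

theorem mem_K_of_adm {u : Fin m → L2 N} (h : ∀ i, Adm (u i)) : u ∈ K N m :=
  mem_K_iff.2 fun i => ⟨(h i).hasGrad, (h i).nonneg⟩

theorem EReal_coe_sum {ι : Type*} (s : Finset ι) (g : ι → ℝ) :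
    ((∑ i ∈ s, g i : ℝ) : EReal) = ∑ i ∈ s, (g i : EReal) := by
  classical
  induction s using Finset.induction_on with
  | empty => simp
  | insert a s ha ih => rw [Finset.sum_insert ha, Finset.sum_insert ha, EReal.coe_add, ih]

/-- The total real-valued energy. -/
def totalEnergy (f : Fin m → E N → ℝ) (u : Fin m → L2 N) : ℝ := ∑ i, energy (f i) (u i)

section Vector

variable {f : Fin m → E N → ℝ} {D : Fin m → Set (E N)} {M c : Fin m → ℝ}

theorem J_eq (hf : ∀ i, Tame (f i) (D i) (M i) (c i)) {u : Fin m → L2 N} (hu : ∀ i, Adm (u i)) :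
    J f u = totalEnergy f u := by
  rw [J, totalEnergy, EReal_coe_sum]
  exact Finset.sum_congr rfl fun i _ => (hf i).extIntegral_eq (hu i).integrable

theorem J_eq_top (hf : ∀ i, Tame (f i) (D i) (M i) (c i)) {u : Fin m → L2 N} (hu : u ∈ K N m)
    (h : ¬ ∀ i, Adm (u i)) : J f u = ⊤ := by
  rw [mem_K_iff] at hu
  push Not at h
  obtain ⟨i, hi⟩ := h
  have hi' : ¬ Integrable (u i) volume := fun h => hi ⟨(hu i).1, (hu i).2, h⟩
  rw [J, ← Finset.add_sum_erase _ _ (Finset.mem_univ i), (hf i).extIntegral_eq_top (hu i).2 hi']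
  refine EReal.top_add_of_ne_bot ?_
  refine Finset.sum_induction _ (fun x : EReal => x ≠ ⊥) (fun a b ha hb => ?_) EReal.zero_ne_bot
    fun j _ => ?_
  · exact EReal.add_ne_bot_iff.2 ⟨ha, hb⟩
  · by_cases hj : Integrable (u j) volume
    · rw [(hf j).extIntegral_eq hj]
      exact EReal.coe_ne_bot _
    · rw [(hf j).extIntegral_eq_top (hu j).2 hj]
      exact top_ne_bot

/-- The competitor 0 has finite energy, so minimizers are integrable and extended values can be
dropped. The class A serves for both `S` and `K`. -/
theorem isMinimizer_iff (hf : ∀ i, Tame (f i) (D i) (M i) (c i)) {A : Set (Fin m → L2 N)}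
    (hA : A ⊆ K N m) (h0 : 0 ∈ A) {u : Fin m → L2 N} :
    IsMinimizer f A u ↔ u ∈ A ∧ (∀ i, Adm (u i)) ∧
      ∀ w ∈ A, (∀ i, Adm (w i)) → totalEnergy f u ≤ totalEnergy f w := by
  constructor
  · rintro ⟨hu, hmin⟩
    have hadm : ∀ i, Adm (u i) := by
      by_contra h
      have h1 : J f u ≤ J f 0 := hmin h0
      rw [J_eq_top hf (hA hu) h, J_eq (u := 0) hf (fun _ => Adm.zero)] at h1
      exact absurd h1 (not_le.2 (EReal.coe_lt_top _))
    refine ⟨hu, hadm, fun w hw hwA => ?_⟩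
    have h1 : J f u ≤ J f w := hmin hw
    rwa [J_eq hf hadm, J_eq hf hwA, EReal.coe_le_coe_iff] at h1
  · rintro ⟨hu, hadm, hmin⟩
    refine ⟨hu, fun w hw => ?_⟩
    change J f u ≤ J f w
    by_cases hwA : ∀ i, Adm (w i)
    · rw [J_eq hf hadm, J_eq hf hwA, EReal.coe_le_coe_iff]
      exact hmin w hw hwA
    · rw [J_eq_top hf (hA hw) hwA]
      exact le_top

/-- The direct method over classes closed under almost everywhere convergence. -/
theorem exists_isMinimizer (hN : 1 ≤ N) (hf : ∀ i, Tame (f i) (D i) (M i) (c i))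
    (hM : ∀ i, 0 < M i) {A : Set (Fin m → L2 N)} (hA : A ⊆ K N m) (h0 : 0 ∈ A)
    (hcl : ∀ (u : ℕ → Fin m → L2 N) (z : Fin m → L2 N), (∀ n, u n ∈ A) → (∀ i, Adm (z i)) →
      (∀ i, ∀ᵐ x, Tendsto (fun n => u n i x) atTop (𝓝 (z i x))) → z ∈ A) :
    ∃ u, IsMinimizer f A u := by
  choose B hB using fun i => ((hf i).exists_coercive hN (hM i)).1
  let V : Set ℝ := totalEnergy f '' {u | u ∈ A ∧ ∀ i, Adm (u i)}
  have hVne : V.Nonempty := ⟨_, 0, ⟨h0, fun _ => Adm.zero⟩, rfl⟩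
  have hVb : BddBelow V := by
    refine ⟨∑ i, B i, ?_⟩
    rintro _ ⟨u, ⟨-, hu⟩, rfl⟩
    exact Finset.sum_le_sum fun i _ => hB i _ (hu i)
  have hex : ∀ n : ℕ, ∃ u, (u ∈ A ∧ ∀ i, Adm (u i)) ∧
      totalEnergy f u < sInf V + 1 / ((n : ℝ) + 1) := by
    intro n
    obtain ⟨_, ⟨u, hu, rfl⟩, hlt⟩ := exists_lt_of_csInf_lt hVne
      (lt_add_of_pos_right (sInf V) (Nat.one_div_pos_of_nat (α := ℝ) (n := n)))
    exact ⟨u, hu, hlt⟩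
  choose u hu hlt using hex
  -- The total is bounded above and the other components below, so each component is bounded above.
  have hcomp : ∀ i n, energy (f i) (u n i) ≤ sInf V + 1 - ∑ j ∈ Finset.univ.erase i, B j := by
    intro i n
    have h1 := hlt n
    rw [totalEnergy, ← Finset.add_sum_erase _ _ (Finset.mem_univ i)] at h1
    have h2 : ∑ j ∈ Finset.univ.erase i, B j ≤
        ∑ j ∈ Finset.univ.erase i, energy (f j) (u n j) :=
      Finset.sum_le_sum fun j _ => hB j _ ((hu n).2 j)
    have h3 : 1 / ((n : ℝ) + 1) ≤ 1 := (div_le_one (by positivity)).2 (by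
      linarith [Nat.cast_nonneg (α := ℝ) n])
    linarith
  choose C hC using fun i => ((hf i).exists_coercive hN (hM i)).2
    (sInf V + 1 - ∑ j ∈ Finset.univ.erase i, B j)
  have hC' : ∀ i n, ‖u n i‖ ≤ C i ∧ ‖weakGrad (u n i)‖ ≤ C i ∧ ∫ x, u n i x ≤ C i := fun i n =>
    hC i _ ((hu n).2 i) (hcomp i n)
  obtain ⟨s, hs, hP⟩ := exists_common_subseq
    (P := fun i s => ∃ z : L2 N, HasGrad z (weakGrad z) ∧
      (∀ y, Tendsto (fun n => inner ℝ (u (s n) i) y) atTop (𝓝 (inner ℝ z y))) ∧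
      (∀ y, Tendsto (fun n => inner ℝ (weakGrad (u (s n) i)) y) atTop
        (𝓝 (inner ℝ (weakGrad z) y))) ∧
      ∀ᵐ x, Tendsto (fun n => u (s n) i x) atTop (𝓝 (z x)))
    (fun i s t => by
      rintro ⟨z, hz, h1, h2, h3⟩ ht
      refine ⟨z, hz, fun y => (h1 y).comp ht.tendsto_atTop,
        fun y => (h2 y).comp ht.tendsto_atTop, ?_⟩
      filter_upwards [h3] with x hx using hx.comp ht.tendsto_atTop)
    (fun i s hs => by
      obtain ⟨t, ht, z, F, hF, h1, h2, h3⟩ := HasGrad.exists_subseq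
        (fun n => ((hu (s n)).2 i).hasGrad) (fun n => (hC' i (s n)).1)
        (fun n => (hC' i (s n)).2.1)
      obtain rfl := hF.weakGrad_eq
      exact ⟨t, ht, z, hF, h1, h2, h3⟩)
  choose z hz h1 h2 h3 using hP
  have hlsc := fun i => (hf i).energy_lsc (u := fun n => u (s n) i) (fun n => (hu (s n)).2 i)
    (fun n => (hC' i (s n)).2.2) (hz i) (h1 i) (h2 i) (h3 i)
  have hzA : ∀ i, Adm (z i) := fun i => (hlsc i).1
  have hle : totalEnergy f z ≤ sInf V := by
    refine le_of_forall_pos_le_add fun ε hε => ?_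
    have hm : (0 : ℝ) < m + 1 := by positivity
    have hev : ∀ᶠ n in atTop, totalEnergy f z - ε ≤ sInf V + 1 / ((s n : ℝ) + 1) := by
      have hall := eventually_all.2 fun i => (hlsc i).2 (ε / (m + 1)) (by positivity)
      filter_upwards [hall] with n hn
      refine le_trans ?_ (hlt (s n)).le
      have hsum := Finset.sum_le_sum (s := Finset.univ) fun i _ => hn i
      rw [Finset.sum_sub_distrib, Finset.sum_const, Finset.card_univ, Fintype.card_fin,
        nsmul_eq_mul] at hsum
      have : (m : ℝ) * (ε / (m + 1)) ≤ ε := by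
        rw [← mul_div_assoc, div_le_iff₀ hm]
        nlinarith
      rw [totalEnergy, totalEnergy]
      linarith
    have hlim : Tendsto (fun n => sInf V + 1 / ((s n : ℝ) + 1)) atTop (𝓝 (sInf V + 0)) :=
      (tendsto_one_div_add_atTop_nhds_zero_nat.comp hs.tendsto_atTop).const_add _
    have := ge_of_tendsto hlim hev
    linarith
  refine ⟨z, (isMinimizer_iff hf hA h0).2 ⟨hcl _ z (fun n => (hu (s n)).1) hzA h3, hzA,
    fun w hw hwA => hle.trans (csInf_le hVb ⟨w, ⟨hw, hwA⟩, rfl⟩)⟩⟩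

theorem zero_mem_S : (0 : Fin m → L2 N) ∈ S N m := by
  refine ⟨mem_K_of_adm (u := 0) fun _ => Adm.zero, fun i j _ => ?_⟩
  filter_upwards [Lp.coeFn_zero ℝ 2 (volume : Measure (E N))] with x hx
  simp only [Pi.zero_apply]
  rw [hx]
  simp

theorem zero_mem_K : (0 : Fin m → L2 N) ∈ K N m := S_subset_K zero_mem_S

/-- The products pass to the limit pointwise; weak convergence alone would not preserve this
nonconvex constraint. -/
theorem S_closed (u : ℕ → Fin m → L2 N) (z : Fin m → L2 N) (hu : ∀ n, u n ∈ S N m)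
    (hz : ∀ i, Adm (z i)) (h : ∀ i, ∀ᵐ x, Tendsto (fun n => u n i x) atTop (𝓝 (z i x))) :
    z ∈ S N m := by
  refine ⟨mem_K_of_adm hz, fun i j hij => ?_⟩
  filter_upwards [h i, h j, ae_all_iff.2 fun n => (hu n).2 i j hij] with x h1 h2 h3
  exact tendsto_nhds_unique (h1.mul h2) (tendsto_const_nhds.congr fun n => (h3 n).symm)

theorem IsMinimizer.unique (hN : 1 ≤ N) (hf : ∀ i, Tame (f i) (D i) (M i) (c i))
    {u v : Fin m → L2 N} (hu : IsMinimizer f (K N m) u) (hv : IsMinimizer f (K N m) v) :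
    u = v := by
  rw [isMinimizer_iff hf subset_rfl zero_mem_K] at hu hv
  obtain ⟨huK, huA, humin⟩ := hu
  obtain ⟨hvK, hvA, hvmin⟩ := hv
  have hA := fun i => (huA i).half_add (hvA i)
  have h1 := humin _ (mem_K_of_adm hA) hA
  have h2 := hvmin u huK huA
  have h3 : totalEnergy f (fun i => (2⁻¹ : ℝ) • (u i + v i)) =
      2⁻¹ * totalEnergy f u + 2⁻¹ * totalEnergy f v -
        8⁻¹ * ∑ i, ‖weakGrad (u i) - weakGrad (v i)‖ ^ 2 := by
    simp only [totalEnergy, Finset.mul_sum]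
    rw [← Finset.sum_add_distrib, ← Finset.sum_sub_distrib]
    exact Finset.sum_congr rfl fun i _ => (hf i).energy_half_add (huA i) (hvA i)
  have h4 : ∑ i, ‖weakGrad (u i) - weakGrad (v i)‖ ^ 2 = 0 :=
    le_antisymm (by linarith) (Finset.sum_nonneg fun i _ => sq_nonneg _)
  rw [Finset.sum_eq_zero_iff_of_nonneg fun i _ => sq_nonneg _] at h4
  funext i
  refine HasGrad.eq_of_weakGrad_eq hN (huA i).hasGrad (hvA i).hasGrad ?_
  simpa [sub_eq_zero] using h4 i (Finset.mem_univ i)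

/-- Segregated minimizers lie below the unconstrained minimizer. -/
theorem IsMinimizer.ae_le (hN : 1 ≤ N) (hf : ∀ i, Tame (f i) (D i) (M i) (c i))
    {u v : Fin m → L2 N} (hu : IsMinimizer f (S N m) u) (hv : IsMinimizer f (K N m) v) (i : Fin m) :
    ∀ᵐ x, u i x ≤ v i x := by
  have hv' := hv
  rw [isMinimizer_iff hf S_subset_K zero_mem_S] at hu
  rw [isMinimizer_iff hf subset_rfl zero_mem_K] at hv'
  obtain ⟨huS, huA, humin⟩ := hu
  obtain ⟨hvK, hvA, hvmin⟩ := hv'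
  have hinf := fun i => (huA i).inf (hvA i)
  have hsup := fun i => (huA i).sup (hvA i)
  -- Lowering nonnegative components keeps them segregated: where u i vanishes, so does its minimum
  -- with v i ≥ 0.
  have hS : (fun i => u i ⊓ v i) ∈ S N m := by
    refine ⟨mem_K_of_adm hinf, fun i j hij => ?_⟩
    filter_upwards [Lp.coeFn_inf (u i) (v i), Lp.coeFn_inf (u j) (v j), huS.2 i j hij,
      (hvA i).nonneg, (hvA j).nonneg] with x h1 h2 h3 h4 h5
    rw [h1, h2, Pi.inf_apply, Pi.inf_apply]
    rcases mul_eq_zero.1 h3 with h | h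
    · rw [h, inf_eq_left.2 h4, zero_mul]
    · rw [h, inf_eq_left.2 h5, mul_zero]
  have h1 := humin _ hS hinf
  have h2 : totalEnergy f (fun i => u i ⊓ v i) + totalEnergy f (fun i => u i ⊔ v i) ≤
      totalEnergy f u + totalEnergy f v := by
    simp only [totalEnergy]
    rw [← Finset.sum_add_distrib, ← Finset.sum_add_distrib]
    exact Finset.sum_le_sum fun i _ => (hf i).energy_inf_add_sup_le (huA i) (hvA i)
  -- E(u) ≤ E(u ⊓ v) and submodularity leave E(u ⊔ v) ≤ E(v), so uniqueness over `K` applies.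
  have hsupmin : IsMinimizer f (K N m) (fun i => u i ⊔ v i) :=
    (isMinimizer_iff hf subset_rfl zero_mem_K).2 ⟨mem_K_of_adm hsup, hsup, fun w hw hwA => by
      linarith [hvmin w hw hwA]⟩
  have heq := congrFun (IsMinimizer.unique hN hf hsupmin hv) i
  exact (Lp.coeFn_le (u i) (v i)).2 (sup_eq_right.1 heq)

/-- Over `K` the components decouple: one can be replaced freely, which segregation would forbid.
This reduces compactness of supports to the scalar barrier comparison. -/
theorem IsMinimizer.energy_le (hf : ∀ i, Tame (f i) (D i) (M i) (c i)) {v : Fin m → L2 N}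
    (hv : IsMinimizer f (K N m) v) (i : Fin m) {w : L2 N} (hw : Adm w) :
    energy (f i) (v i) ≤ energy (f i) w := by
  rw [isMinimizer_iff hf subset_rfl zero_mem_K] at hv
  obtain ⟨-, hvA, hvmin⟩ := hv
  have hA : ∀ j, Adm (Function.update v i w j) := by
    intro j
    rcases eq_or_ne j i with rfl | hj
    · simpa using hw
    · simpa [hj] using hvA j
  have h1 := hvmin _ (mem_K_of_adm hA) hA
  rw [totalEnergy, totalEnergy, ← Finset.add_sum_erase _ _ (Finset.mem_univ i),
    ← Finset.add_sum_erase (a := i) _ (fun j => energy (f j) (Function.update v i w j))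
      (Finset.mem_univ i)] at h1
  have h2 : ∑ j ∈ Finset.univ.erase i, energy (f j) (Function.update v i w j) =
      ∑ j ∈ Finset.univ.erase i, energy (f j) (v j) :=
    Finset.sum_congr rfl fun j hj => by
      rw [Function.update_of_ne (Finset.ne_of_mem_erase hj)]
  rw [h2, Function.update_self] at h1
  linarith

theorem IsMinimizer.isCompact_essSupport (hN : 1 ≤ N)
    (hf : ∀ i, Tame (f i) (D i) (M i) (c i)) (hD : ∀ i, IsCompact (D i)) (hM : ∀ i, 0 < M i)
    {v : Fin m → L2 N} (hv : IsMinimizer f (K N m) v) (i : Fin m) :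
    IsCompact (essSupport (v i)) := by
  have hvA := ((isMinimizer_iff hf subset_rfl zero_mem_K).1 hv).2.1 i
  obtain ⟨w, hw, hle⟩ := (hf i).exists_le_isTest hN (hD i) (hM i) hvA
    fun w hw => hv.energy_le hf i hw
  exact hw.isCompact_essSupport.of_isClosed_subset (isClosed_essSupport _)
    (essSupport_subset_of_le hvA.nonneg hle)

end Vector

end Segregation

end

theorem mainTheorem1 (N m : ℕ) (hN : 1 ≤ N)
    (f : Fin m → Segregation.E N → ℝ) (hf : ∀ i, Segregation.ConditionA (f i)) :
    (∃ u, Segregation.IsMinimizer f (Segregation.S N m) u) ∧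
    (∀ u, Segregation.IsMinimizer f (Segregation.S N m) u →
      ∀ i, IsCompact (Segregation.essSupport (u i))) ∧
    (∃! v, Segregation.IsMinimizer f (Segregation.K N m) v) ∧
    (∀ u v, Segregation.IsMinimizer f (Segregation.S N m) u →
      Segregation.IsMinimizer f (Segregation.K N m) v →
      ∀ i, Segregation.essSupport (u i) ⊆ Segregation.essSupport (v i)) := by
  choose D M c hD hM hT using fun i => (hf i).exists_tame
  obtain ⟨v, hv⟩ := Segregation.exists_isMinimizer hN hT hM subset_rfl Segregation.zero_mem_K
    (fun _ _ _ hz _ => Segregation.mem_K_of_adm hz)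
  have hsub : ∀ u v, Segregation.IsMinimizer f (Segregation.S N m) u →
      Segregation.IsMinimizer f (Segregation.K N m) v →
      ∀ i, Segregation.essSupport (u i) ⊆ Segregation.essSupport (v i) := fun u v hu hv i =>
    Segregation.essSupport_subset_of_le (hu.1.1 i).2 (hu.ae_le hN hT hv i)
  refine ⟨Segregation.exists_isMinimizer hN hT hM Segregation.S_subset_K Segregation.zero_mem_S
    Segregation.S_closed, fun u hu i => ?_, ⟨v, hv, fun w hw => hw.unique hN hT hv⟩, hsub⟩
  exact (hv.isCompact_essSupport hN hT hD hM i).of_isClosed_subset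
    (Segregation.isClosed_essSupport _) (hsub u v hu hv i)
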